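/- Write $\mathbb{R}_+=(0,\infty)$ with Lebesgue measure, and let $\sigma\in(0,1]$. There are constants $C$, depending only on $\sigma$, and $C_p$ ($1<p<\infty$), depending only on $\sigma$ and $p$, such that the following holds. Let $X$ and $Y$ be reflexive Banach spaces (both real or both complex), let $r\in(1,\infty]$, $M\in\mathbb{R}$, and let $T:L^r(\mathbb{R}_+;X)\to L^r(\mathbb{R}_+;Y)$ be a bounded linear operator with operator norm $B$. Suppose that $T$ is a singular integral operator of Volterra type, that is, there are bounded linear operators $K(t,s):X\to Y$, $0<s<t<\infty$, such that $$\|K(t,s)\|\le \frac{M}{t-s}\qquad (0<s<t),$$ $$\|K(t,s)-K(t,s_0)\|\le \frac{M|s-s_0|^\sigma}{(t-s_0)^{1+\sigma}}\qquad\text{if } 0<s,s_0<t \text{ and } t-s_0\ge 2|s-s_0|,$$ $$\|K(t,s)-K(t_0,s)\|\le \frac{M|t-t_0|^\sigma}{(t_0-s)^{1+\sigma}}\qquad\text{if } 0<s<t,t_0 \text{ and } t_0-s\ge 2|t-t_0|,$$ and such that, for every $f\in L^r(\mathbb{R}_+;X)$ with compact support in $\mathbb{R}_+$, $$Tf(t)=\int_0^t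 K(t,s)f(s)\,ds\qquad\text{for almost every } t\in\mathbb{R}_+ \text{ outside the support of } f.$$ Then $T$, restricted to the continuous functions $\mathbb{R}_+\to X$ with compact support, is of weak type $(1,1)$ and of strong type $(p,p)$ for every $1<p<\infty$, in the following sense. 1. It extends to a linear map $T_1$ from $L^1(\mathbb{R}_+;X)$ to the (classes of) strongly measurable functions $\mathbb{R}_+\to Y$ with $$\|T_1f\|_{L^{1,\infty}(\mathbb{R}_+;Y)}:=\sup_{a>0}a\,\bigl|\{t\in\mathbb{R}_+:\|T_1f(t)\|_Y>a\}\bigr|\le C(M+B)\|f\|_{L^1(\mathbb{R}_+;X)}\qquad\text{for all } f\in L^1(\mathbb{R}_+;X).$$ 2. For every $1<p<\infty$ it extends to a bounded linear operator $T_p:L^p(\mathbb{R}_+;X)\to L^p(\mathbb{R}_+;Y)$ with $$\|T_pf\|_{L^p(\mathbb{R}_+;Y)}\le C_p(M+B)\|f\|_{L^p(\mathbb{R}_+;X)}\qquad\text{for all } f\in L^p(\mathbb{R}_+;X).$$ If $r<\infty$, these extensions moreover coincide with $T$ on all of $L^1\cap L^r$ and of $L^p\cap L^r$, respectively. -/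

import Mathlib

open MeasureTheory Set
open scoped ENNReal NNReal

noncomputable section

/-- Lebesgue measure on the open half-line `ℝ₊ = (0, ∞)`, as a measure on `ℝ`. The Bochner space
`L^p(ℝ₊; X)` is `Lp X p halfLine`. -/
def halfLine : Measure ℝ := volume.restrict (Ioi 0)

/-- A normed space is reflexive if the canonical isometric embedding into its (topological)
double dual is onto. -/
def IsReflexiveSpace (𝕜 X : Type*) [RCLike 𝕜] [NormedAddCommGroup X] [NormedSpace 𝕜 X] : Prop :=
  Function.Surjective (NormedSpace.inclusionInDoubleDual 𝕜 X)

/-- Standard singular kernels of Volterra type, with constant `M` and Hölder exponent `σ`.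
Only the values `K t s` with `0 < s < t` are constrained (and used). -/
structure IsVolterraKernel {𝕜 X Y : Type*} [RCLike 𝕜]
    [NormedAddCommGroup X] [NormedSpace 𝕜 X] [NormedAddCommGroup Y] [NormedSpace 𝕜 Y]
    (σ M : ℝ) (K : ℝ → ℝ → X →L[𝕜] Y) : Prop where
  /-- The size condition. -/
  size : ∀ t s : ℝ, 0 < s → s < t → ‖K t s‖ ≤ M / (t - s)
  /-- Hölder-type smoothness in the second variable. -/
  smooth_right : ∀ t s s₀ : ℝ, 0 < s → 0 < s₀ → s < t → s₀ < t → 2 * |s - s₀| ≤ t - s₀ →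
    ‖K t s - K t s₀‖ ≤ M * |s - s₀| ^ σ / (t - s₀) ^ (1 + σ)
  /-- Hölder-type smoothness in the first variable. -/
  smooth_left : ∀ t t₀ s : ℝ, 0 < s → s < t → s < t₀ → 2 * |t - t₀| ≤ t₀ - s →
    ‖K t s - K t₀ s‖ ≤ M * |t - t₀| ^ σ / (t₀ - s) ^ (1 + σ)

/-- The Bochner integral `∫₀ᵗ K(t, s) f(s) ds`, where `Y` is regarded as a real Banach space by
restriction of scalars from `𝕜` to `ℝ`. -/
def volterraIntegral {𝕜 X Y : Type*} [RCLike 𝕜]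
    [NormedAddCommGroup X] [NormedSpace 𝕜 X] [NormedAddCommGroup Y] [NormedSpace 𝕜 Y]
    (K : ℝ → ℝ → X →L[𝕜] Y) (f : ℝ → X) (t : ℝ) : Y :=
  letI : NormedSpace ℝ Y := NormedSpace.restrictScalars ℝ 𝕜 Y
  ∫ s in (0 : ℝ)..t, K t s (f s)

/-- A bounded linear operator `T : L^r(ℝ₊; X) → L^r(ℝ₊; Y)` is a singular integral operator of
Volterra type (with constants `σ`, `M`) if, for some standard singular kernel `K` of Volterra type,
`T f (t) = ∫₀ᵗ K(t, s) f(s) ds` for almost every `t ∈ ℝ₊` outside the support of `f`, whenever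
`f ∈ L^r(ℝ₊; X)` has compact support in `ℝ₊`. The (essential) support of `f` is the smallest
relatively closed set `F` of `ℝ₊` with `f = 0` a.e. outside `F`; requiring the formula off every
compact `F ⊆ ℝ₊` with `f = 0` a.e. outside `F` is the same as requiring it off the support. -/
def IsVolterraOperator {𝕜 X Y : Type*} [RCLike 𝕜]
    [NormedAddCommGroup X] [NormedSpace 𝕜 X] [NormedAddCommGroup Y] [NormedSpace 𝕜 Y]
    (σ M : ℝ) {r : ℝ≥0∞} [Fact (1 ≤ r)] (T : Lp X r halfLine →L[𝕜] Lp Y r halfLine) : Prop :=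
  ∃ K : ℝ → ℝ → X →L[𝕜] Y, IsVolterraKernel σ M K ∧
    ∀ (f : Lp X r halfLine) (F : Set ℝ), IsCompact F → F ⊆ Ioi 0 →
      (∀ᵐ s ∂halfLine, s ∉ F → f s = 0) →
      ∀ᵐ t ∂halfLine, t ∉ F → T f t = volterraIntegral K f t

/-- The weak-`L¹` quasi-norm `sup_{a > 0} a · |{t ∈ ℝ₊ : ‖g t‖ > a}|`. -/
def weakL1Norm {Y : Type*} [NormedAddCommGroup Y] (g : ℝ → Y) : ℝ≥0∞ :=
  ⨆ a : ℝ≥0, (a : ℝ≥0∞) * halfLine {t | (a : ℝ) < ‖g t‖}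

/-- `f` coincides a.e. on `ℝ₊` with a continuous function having compact support in `ℝ₊`. -/
def IsTestFunction {X : Type*} [NormedAddCommGroup X] (f : ℝ → X) : Prop :=
  ∃ u : ℝ → X, Continuous u ∧ HasCompactSupport u ∧ tsupport u ⊆ Ioi 0 ∧ f =ᵐ[halfLine] u

/-- The map `S`, defined on `L^p(ℝ₊; X)`, is an extension to `L^p(ℝ₊; X)` of the operator `T`, given
on `L^r(ℝ₊; X)`: it coincides with `T` on `L^p ∩ L^r` if `r < ∞`, and on the continuous functions
with compact support in `ℝ₊` in every case (including `r = ∞`). -/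
def Extends {𝕜 X Y : Type*} [RCLike 𝕜]
    [NormedAddCommGroup X] [NormedSpace 𝕜 X] [NormedAddCommGroup Y] [NormedSpace 𝕜 Y]
    {p r : ℝ≥0∞} [Fact (1 ≤ r)] (S : Lp X p halfLine → (ℝ →ₘ[halfLine] Y))
    (T : Lp X r halfLine →L[𝕜] Lp Y r halfLine) : Prop :=
  ∀ (f : Lp X p halfLine) (g : Lp X r halfLine), f =ᵐ[halfLine] g →
    (r ≠ ∞ ∨ IsTestFunction f) → S f =ᵐ[halfLine] T g

end

/-!
The proof discretizes `T`. Averaging over the dyadic cells of generation `n` on both sides turns `T`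
into a finite matrix of bounded operators `X → Y` (`opMatrix`), acting on the values of step
functions. Uniformly in `n`, such a matrix inherits the bound of `T` on `L^r`. Since `T` is given by
`K` off the support, the entries at positive distance from the diagonal are averages of `K` below
the diagonal and vanish above it, and the smoothness of `K` in its second and first variable becomes
Hörmander's condition for the columns and for the rows, with the constant `M / σ`
(`hormander_opMatrix`, `hormander_dualMatrix_opMatrix`).

For a finite matrix, the Calderón–Zygmund decomposition is a finite bisection of an interval of
indices. It yields the weak type `(1, 1)` bound (`weakOne_of_hormander`). The constant does not
depend on `r`, because the good part is bounded by half of the level considered: for such sequences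
the strong type `(r, r)` bound with constant `1` implies a weak type `(1, 1)` bound with constant
`1` (`HeightBound`), also for `r = ∞`. The matrices are scaled to this normalisation first.

Interpolation with the exponent `r` would give constants that blow up as `p` approaches `r`, and
nothing for `p > r`. If `r ≥ 2p`, the strong type `(r, r)` bound is used as a `HeightBound` with the
exponent `2p` instead. If `r < 2p`, the matrix of adjoints is bounded on `ℓ^r'`, where `1/r + 1/r' =
1`, and satisfies Hörmander's condition. The same argument bounds it with the exponent conjugate to
`4p`. Hence the original matrix is bounded with the exponent `4p`, and interpolation between `1` and
`4p` concludes (`strongBound_of_hormander`). For finite matrices the duality of vector-valued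
sequence spaces is elementary, and the way back needs only that a space embeds isometrically into
its bidual.

A step function belongs to all later generations. Letting the generation tend to infinity,
Lebesgue's differentiation theorem and Fatou's lemma give the bounds for `T` on step functions. For
`f` in `L^1` or `L^p`, the images under `T` of the dyadic averages of `f` are therefore Cauchy in
measure. Their limit defines the extension (`exists_extension`), and the bounds pass to it. It
agrees with `T` where it should (`extends_of_tendstoInMeasure`): the averages of an element of `L^r`
converge to it in `L^r` if `r < ∞`, and those of a continuous function with compact support in the
half-line converge uniformly.
-/

/-! ### Operator matrices on finite sequences -/

section Matrices

variable {𝕜 X Y : Type*} [RCLike 𝕜]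
  [NormedAddCommGroup X] [NormedSpace 𝕜 X] [NormedAddCommGroup Y] [NormedSpace 𝕜 Y]

/-- The action of the leading `N × N` block of a matrix of bounded operators on a sequence. -/
def matApply (N : ℕ) (A : ℕ → ℕ → X →L[𝕜] Y) (f : ℕ → X) (i : ℕ) : Y :=
  ∑ j ∈ Finset.range N, A i j (f j)

/-- A weak type `(q, q)` bound with constant `1`, required only at levels dominating the sequence.
It follows from a strong type `(r, r)` bound with constant `1`, for any `r ∈ [q, ∞]`. -/
def HeightBound (N : ℕ) (A : ℕ → ℕ → X →L[𝕜] Y) (q : ℝ) : Prop :=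
  ∀ (f : ℕ → X) (a : ℝ), 0 < a → (∀ j < N, ‖f j‖ ≤ a) →
    a ^ q * ((Finset.range N).filter fun i => a < ‖matApply N A f i‖).card ≤
      ∑ j ∈ Finset.range N, ‖f j‖ ^ q

/-- Hörmander's condition: off the block `[a - 3ℓ, a + 4ℓ)`, the columns of `A` belonging to a block
`[a, a + ℓ)` differ from the first of them by at most `c` in `ℓ¹`-norm. The lower end is written
additively, since `a - 3ℓ` may be negative. -/
def Hormander (N : ℕ) (A : ℕ → ℕ → X →L[𝕜] Y) (c : ℝ) : Prop :=
  ∀ a ℓ j : ℕ, a ≤ j → j < a + ℓ → a + ℓ ≤ N →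
    ∑ i ∈ (Finset.range N).filter (fun i => ¬ (a ≤ i + 3 * ℓ ∧ i < a + 4 * ℓ)),
      ‖A i j - A i a‖ ≤ c

/-- The weak type `(1, 1)` bound with constant `c`. -/
def WeakOne (N : ℕ) (A : ℕ → ℕ → X →L[𝕜] Y) (c : ℝ) : Prop :=
  ∀ (f : ℕ → X) (a : ℝ), 0 < a →
    a * ((Finset.range N).filter fun i => a < ‖matApply N A f i‖).card ≤
      c * ∑ j ∈ Finset.range N, ‖f j‖

/-- The strong type `(p, p)` bound with constant `c`, for finite `p`. -/
def StrongBound (N : ℕ) (A : ℕ → ℕ → X →L[𝕜] Y) (p c : ℝ) : Prop :=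
  ∀ f : ℕ → X, ∑ i ∈ Finset.range N, ‖matApply N A f i‖ ^ p ≤
    c ^ p * ∑ j ∈ Finset.range N, ‖f j‖ ^ p

/-- The strong type `(∞, ∞)` bound with constant `c`. -/
def SupBound (N : ℕ) (A : ℕ → ℕ → X →L[𝕜] Y) (c : ℝ) : Prop :=
  ∀ (f : ℕ → X) (R : ℝ), (∀ j < N, ‖f j‖ ≤ R) → ∀ i < N, ‖matApply N A f i‖ ≤ c * R

lemma matApply_add (N : ℕ) (A : ℕ → ℕ → X →L[𝕜] Y) (f g : ℕ → X) (i : ℕ) :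
    matApply N A (f + g) i = matApply N A f i + matApply N A g i := by
  simp [matApply, Finset.sum_add_distrib]

lemma matApply_sum {ι : Type*} (N : ℕ) (A : ℕ → ℕ → X →L[𝕜] Y) (S : Finset ι) (f : ι → ℕ → X)
    (i : ℕ) : matApply N A (fun j => ∑ k ∈ S, f k j) i = ∑ k ∈ S, matApply N A (f k) i := by
  simp only [matApply, map_sum]
  exact Finset.sum_comm

/-! ### Calderón–Zygmund decomposition -/

/-- The stopping blocks of the Calderón–Zygmund decomposition at height `lam`, as pairs of a first
index and a length. Bisection stops as soon as the average of `w` exceeds `lam`, so that the average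
over a stopping block is at most `2 * lam`. -/
lemma exists_stopping (w : ℕ → ℝ) (hw : ∀ j, 0 ≤ w j) (lam : ℝ) (L : ℕ) : ∀ s : ℕ,
    ∑ j ∈ Finset.Ico s (s + 2 ^ L), w j ≤ lam * 2 ^ L →
    ∃ S : Finset (ℕ × ℕ),
      (∀ Q ∈ S, s ≤ Q.1 ∧ Q.1 + Q.2 ≤ s + 2 ^ L ∧ 0 < Q.2 ∧
        lam * Q.2 < ∑ j ∈ Finset.Ico Q.1 (Q.1 + Q.2), w j ∧
        ∑ j ∈ Finset.Ico Q.1 (Q.1 + Q.2), w j ≤ 2 * lam * Q.2) ∧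
      (S : Set (ℕ × ℕ)).PairwiseDisjoint (fun Q => Finset.Ico Q.1 (Q.1 + Q.2)) ∧
      ∀ j ∈ Finset.Ico s (s + 2 ^ L), (∀ Q ∈ S, j ∉ Finset.Ico Q.1 (Q.1 + Q.2)) → w j ≤ lam := by
  induction L with
  | zero =>
    intro s hs
    refine ⟨∅, by simp, by simp, ?_⟩
    intro j hj _
    have : j = s := by simp at hj; omega
    subst this
    simpa using hs
  | succ L ih =>
    -- The alternative for one half of the block: it is a stopping block or can be bisected.
    have half : ∀ s : ℕ, ∑ j ∈ Finset.Ico s (s + 2 ^ L), w j ≤ 2 * lam * (2 ^ L : ℕ) →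
        ∃ S : Finset (ℕ × ℕ),
          (∀ Q ∈ S, s ≤ Q.1 ∧ Q.1 + Q.2 ≤ s + 2 ^ L ∧ 0 < Q.2 ∧
            lam * Q.2 < ∑ j ∈ Finset.Ico Q.1 (Q.1 + Q.2), w j ∧
            ∑ j ∈ Finset.Ico Q.1 (Q.1 + Q.2), w j ≤ 2 * lam * Q.2) ∧
          (S : Set (ℕ × ℕ)).PairwiseDisjoint (fun Q => Finset.Ico Q.1 (Q.1 + Q.2)) ∧
          ∀ j ∈ Finset.Ico s (s + 2 ^ L),
            (∀ Q ∈ S, j ∉ Finset.Ico Q.1 (Q.1 + Q.2)) → w j ≤ lam := by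
      intro s hs
      by_cases h : ∑ j ∈ Finset.Ico s (s + 2 ^ L), w j ≤ lam * 2 ^ L
      · exact ih s h
      · refine ⟨{(s, 2 ^ L)}, ?_, by simp, ?_⟩
        · intro Q hQ
          obtain rfl := Finset.mem_singleton.1 hQ
          refine ⟨le_rfl, le_rfl, by positivity, ?_, hs⟩
          push Not at h
          push_cast
          exact h
        · intro j hj hj'
          exact absurd hj (hj' _ (Finset.mem_singleton_self _))
    intro s hs
    have e : s + 2 ^ (L + 1) = (s + 2 ^ L) + 2 ^ L := by ring
    have hsplit : ∑ j ∈ Finset.Ico s (s + 2 ^ L), w j +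
        ∑ j ∈ Finset.Ico (s + 2 ^ L) (s + 2 ^ L + 2 ^ L), w j =
        ∑ j ∈ Finset.Ico s (s + 2 ^ (L + 1)), w j := by
      rw [e]
      exact Finset.sum_Ico_consecutive _ (Nat.le_add_right _ _) (Nat.le_add_right _ _)
    have h1 : 0 ≤ ∑ j ∈ Finset.Ico s (s + 2 ^ L), w j := Finset.sum_nonneg fun j _ => hw j
    have h2 : 0 ≤ ∑ j ∈ Finset.Ico (s + 2 ^ L) (s + 2 ^ L + 2 ^ L), w j :=
      Finset.sum_nonneg fun j _ => hw j
    have e' : lam * 2 ^ (L + 1) = 2 * lam * (2 ^ L : ℕ) := by push_cast; ring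
    rw [e'] at hs
    obtain ⟨S₁, a₁, b₁, c₁⟩ := half s (by linarith)
    obtain ⟨S₂, a₂, b₂, c₂⟩ := half (s + 2 ^ L) (by linarith)
    refine ⟨S₁ ∪ S₂, ?_, ?_, ?_⟩
    · intro Q hQ
      rcases Finset.mem_union.1 hQ with h | h
      · obtain ⟨x1, x2, x3⟩ := a₁ Q h
        exact ⟨x1, by omega, x3⟩
      · obtain ⟨x1, x2, x3⟩ := a₂ Q h
        exact ⟨by omega, by omega, x3⟩
    · rw [Finset.coe_union, Set.pairwiseDisjoint_union]
      refine ⟨b₁, b₂, ?_⟩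
      intro Q hQ Q' hQ' _
      obtain ⟨x1, x2, x3⟩ := a₁ Q hQ
      obtain ⟨y1, y2, y3⟩ := a₂ Q' hQ'
      refine Finset.disjoint_left.2 ?_
      intro j hj hj'
      simp only [Finset.mem_Ico] at hj hj'
      omega
    · intro j hj hj'
      by_cases hlt : j < s + 2 ^ L
      · exact c₁ j (by simp at hj ⊢; omega) fun Q hQ => hj' Q (Finset.mem_union_left _ hQ)
      · exact c₂ j (by simp at hj ⊢; omega) fun Q hQ => hj' Q (Finset.mem_union_right _ hQ)

/-- The part of `f` on the block `Q`, corrected to have mean zero. -/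
def badPart (𝕜 : Type*) {X : Type*} [RCLike 𝕜] [NormedAddCommGroup X] [NormedSpace 𝕜 X]
    (f : ℕ → X) (Q : ℕ × ℕ) (j : ℕ) : X :=
  if j ∈ Finset.Ico Q.1 (Q.1 + Q.2) then
    f j - (Q.2 : 𝕜)⁻¹ • ∑ k ∈ Finset.Ico Q.1 (Q.1 + Q.2), f k else 0

lemma sum_badPart (f : ℕ → X) (Q : ℕ × ℕ) (hQ : 0 < Q.2) :
    ∑ j ∈ Finset.Ico Q.1 (Q.1 + Q.2), badPart 𝕜 f Q j = 0 := by
  have h : ∀ j ∈ Finset.Ico Q.1 (Q.1 + Q.2), badPart 𝕜 f Q j =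
      f j - (Q.2 : 𝕜)⁻¹ • ∑ k ∈ Finset.Ico Q.1 (Q.1 + Q.2), f k := by
    intro j hj
    rw [badPart, if_pos hj]
  rw [Finset.sum_congr rfl h, Finset.sum_sub_distrib, Finset.sum_const, Nat.card_Ico,
    add_tsub_cancel_left, ← Nat.cast_smul_eq_nsmul 𝕜, smul_smul,
    mul_inv_cancel₀ (by exact_mod_cast hQ.ne'), one_smul, sub_self]

lemma norm_average_le (f : ℕ → X) (Q : ℕ × ℕ) :
    ‖(Q.2 : 𝕜)⁻¹ • ∑ k ∈ Finset.Ico Q.1 (Q.1 + Q.2), f k‖ ≤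
      (Q.2 : ℝ)⁻¹ * ∑ k ∈ Finset.Ico Q.1 (Q.1 + Q.2), ‖f k‖ := by
  rw [norm_smul, norm_inv, RCLike.norm_natCast]
  gcongr
  exact norm_sum_le _ _

lemma sum_norm_badPart_le (f : ℕ → X) (Q : ℕ × ℕ) (hQ : 0 < Q.2) :
    ∑ j ∈ Finset.Ico Q.1 (Q.1 + Q.2), ‖badPart 𝕜 f Q j‖ ≤
      2 * ∑ j ∈ Finset.Ico Q.1 (Q.1 + Q.2), ‖f j‖ := by
  have h : ∀ j ∈ Finset.Ico Q.1 (Q.1 + Q.2), ‖badPart 𝕜 f Q j‖ ≤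
      ‖f j‖ + (Q.2 : ℝ)⁻¹ * ∑ k ∈ Finset.Ico Q.1 (Q.1 + Q.2), ‖f k‖ := by
    intro j hj
    rw [badPart, if_pos hj]
    exact (norm_sub_le _ _).trans (add_le_add_right (norm_average_le f Q) _)
  refine (Finset.sum_le_sum h).trans (le_of_eq ?_)
  rw [Finset.sum_add_distrib, Finset.sum_const, Nat.card_Ico, add_tsub_cancel_left, nsmul_eq_mul,
    ← mul_assoc, mul_inv_cancel₀ (by exact_mod_cast hQ.ne'), one_mul, two_mul]

/-- Off the enlarged block, Hörmander's condition and the mean value zero bound the image of the bad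
part in `ℓ¹`. -/
lemma sum_norm_matApply_badPart_le {N : ℕ} {A : ℕ → ℕ → X →L[𝕜] Y} (hH : Hormander N A 1)
    (f : ℕ → X) (Q : ℕ × ℕ) (hQ : 0 < Q.2) (hQN : Q.1 + Q.2 ≤ N) :
    ∑ i ∈ (Finset.range N).filter (fun i => ¬ (Q.1 ≤ i + 3 * Q.2 ∧ i < Q.1 + 4 * Q.2)),
      ‖matApply N A (badPart 𝕜 f Q) i‖ ≤ 2 * ∑ j ∈ Finset.Ico Q.1 (Q.1 + Q.2), ‖f j‖ := by
  have hsub : Finset.Ico Q.1 (Q.1 + Q.2) ⊆ Finset.range N := by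
    intro j hj
    simp only [Finset.mem_Ico, Finset.mem_range] at hj ⊢
    omega
  have h1 : ∀ i, matApply N A (badPart 𝕜 f Q) i =
      ∑ j ∈ Finset.Ico Q.1 (Q.1 + Q.2), (A i j - A i Q.1) (badPart 𝕜 f Q j) := by
    intro i
    simp only [sub_apply]
    rw [Finset.sum_sub_distrib, ← map_sum, sum_badPart f Q hQ, map_zero, sub_zero, matApply]
    refine (Finset.sum_subset hsub ?_).symm
    intro j _ hj
    rw [badPart, if_neg hj, map_zero]
  calc _ ≤ ∑ i ∈ (Finset.range N).filter (fun i => ¬ (Q.1 ≤ i + 3 * Q.2 ∧ i < Q.1 + 4 * Q.2)),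
        ∑ j ∈ Finset.Ico Q.1 (Q.1 + Q.2), ‖A i j - A i Q.1‖ * ‖badPart 𝕜 f Q j‖ := by
        refine Finset.sum_le_sum fun i _ => ?_
        rw [h1]
        exact (norm_sum_le _ _).trans (Finset.sum_le_sum fun j _ =>
          ContinuousLinearMap.le_opNorm _ _)
    _ ≤ ∑ j ∈ Finset.Ico Q.1 (Q.1 + Q.2), ‖badPart 𝕜 f Q j‖ := by
        rw [Finset.sum_comm]
        refine Finset.sum_le_sum fun j hj => ?_
        rw [← Finset.sum_mul]
        simp only [Finset.mem_Ico] at hj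
        exact mul_le_of_le_one_left (norm_nonneg _) (hH Q.1 Q.2 j hj.1 hj.2 hQN)
    _ ≤ _ := sum_norm_badPart_le f Q hQ

/-- The level set of a sum is covered by the level sets of the summands at half the level. -/
lemma card_level_add_le (N : ℕ) (A : ℕ → ℕ → X →L[𝕜] Y) (f g : ℕ → X) (a : ℝ) :
    ((Finset.range N).filter fun i => a < ‖matApply N A (f + g) i‖).card ≤
      ((Finset.range N).filter fun i => a / 2 < ‖matApply N A f i‖).card +
      ((Finset.range N).filter fun i => a / 2 < ‖matApply N A g i‖).card := by
  refine (Finset.card_le_card ?_).trans (Finset.card_union_le _ _)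
  intro i hi
  simp only [Finset.mem_filter, Finset.mem_union] at hi ⊢
  have := norm_add_le (matApply N A f i) (matApply N A g i)
  rw [← matApply_add] at this
  by_cases h : a / 2 < ‖matApply N A f i‖
  · exact Or.inl ⟨hi.1, h⟩
  · exact Or.inr ⟨hi.1, by linarith [hi.2]⟩

/-- Chebyshev's inequality for finite sums. -/
lemma mul_card_level_le (s : Finset ℕ) (u : ℕ → ℝ) (hu : ∀ i, 0 ≤ u i) (a : ℝ) :
    a * (s.filter fun i => a < u i).card ≤ ∑ i ∈ s, u i := by
  calc a * (s.filter fun i => a < u i).card = ∑ i ∈ s.filter fun i => a < u i, a := by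
        rw [Finset.sum_const, nsmul_eq_mul, mul_comm]
    _ ≤ ∑ i ∈ s.filter fun i => a < u i, u i :=
        Finset.sum_le_sum fun i hi => (Finset.mem_filter.1 hi).2.le
    _ ≤ _ := Finset.sum_le_sum_of_subset_of_nonneg (Finset.filter_subset _ _) fun i _ _ => hu i

/-- The weak type `(1, 1)` estimate of Calderón and Zygmund for matrices of size `2 ^ L`. With
blocks stopped at height `a / 4`, the good part is at most `a / 2`, so that `HeightBound` applies.
It contributes `6` to the constant, the enlarged blocks contribute `28`, and the bad part off these
blocks `4`. -/
theorem weakOne_of_hormander {L : ℕ} {A : ℕ → ℕ → X →L[𝕜] Y} (hH : Hormander (2 ^ L) A 1)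
    (hB : HeightBound (2 ^ L) A 1) : WeakOne (2 ^ L) A 38 := by
  intro f a ha
  set N := 2 ^ L with hN
  set F := ∑ j ∈ Finset.range N, ‖f j‖ with hF
  have hF0 : 0 ≤ F := Finset.sum_nonneg fun j _ => norm_nonneg _
  by_cases htop : F ≤ a / 4 * 2 ^ L
  swap
  · -- The average over all indices exceeds `a / 4`, and the number of indices is small enough.
    have h1 : (((Finset.range N).filter fun i => a < ‖matApply N A f i‖).card : ℝ) ≤ 2 ^ L := by
      have := Finset.card_filter_le (Finset.range N) fun i => a < ‖matApply N A f i‖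
      rw [Finset.card_range] at this
      exact_mod_cast this
    push Not at htop
    nlinarith
  obtain ⟨S, hS, hdisj, hgood⟩ := exists_stopping (fun j => ‖f j‖) (fun j => norm_nonneg _) (a / 4)
    L 0 (by rw [zero_add, ← Finset.range_eq_Ico]; exact htop)
  simp only [Nat.zero_le, zero_add, true_and] at hS hgood
  have hsum : ∑ Q ∈ S, ∑ j ∈ Finset.Ico Q.1 (Q.1 + Q.2), ‖f j‖ ≤ F := by
    rw [← Finset.sum_biUnion (fun Q hQ Q' hQ' h => hdisj hQ hQ' h)]
    refine Finset.sum_le_sum_of_subset_of_nonneg ?_ fun j _ _ => norm_nonneg _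
    intro j hj
    obtain ⟨Q, hQ, hj⟩ := Finset.mem_biUnion.1 hj
    have := (hS Q hQ).1
    simp only [Finset.mem_Ico, Finset.mem_range] at hj ⊢
    omega
  set b : ℕ → X := fun j => ∑ Q ∈ S, badPart 𝕜 f Q j with hb
  set g : ℕ → X := f - b with hg
  have hfgb : f = g + b := by simp [hg]
  have hbn : ∑ j ∈ Finset.range N, ‖b j‖ ≤ 2 * F := by
    calc ∑ j ∈ Finset.range N, ‖b j‖ ≤ ∑ j ∈ Finset.range N, ∑ Q ∈ S, ‖badPart 𝕜 f Q j‖ :=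
          Finset.sum_le_sum fun j _ => norm_sum_le _ _
      _ = ∑ Q ∈ S, ∑ j ∈ Finset.range N, ‖badPart 𝕜 f Q j‖ := Finset.sum_comm
      _ = ∑ Q ∈ S, ∑ j ∈ Finset.Ico Q.1 (Q.1 + Q.2), ‖badPart 𝕜 f Q j‖ := by
          refine Finset.sum_congr rfl fun Q hQ => (Finset.sum_subset ?_ ?_).symm
          · intro j hj
            have := (hS Q hQ).1
            simp only [Finset.mem_Ico, Finset.mem_range] at hj ⊢
            omega
          · intro j _ hj
            rw [badPart, if_neg hj, norm_zero]
      _ ≤ ∑ Q ∈ S, 2 * ∑ j ∈ Finset.Ico Q.1 (Q.1 + Q.2), ‖f j‖ :=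
          Finset.sum_le_sum fun Q hQ => sum_norm_badPart_le f Q (hS Q hQ).2.1
      _ ≤ 2 * F := by
          rw [← Finset.mul_sum]
          linarith
  have hgn : ∑ j ∈ Finset.range N, ‖g j‖ ≤ 3 * F := by
    calc ∑ j ∈ Finset.range N, ‖g j‖ ≤ ∑ j ∈ Finset.range N, (‖f j‖ + ‖b j‖) :=
          Finset.sum_le_sum fun j _ => norm_sub_le _ _
      _ ≤ 3 * F := by
          rw [Finset.sum_add_distrib]
          linarith
  have hgsup : ∀ j < N, ‖g j‖ ≤ a / 2 := by
    intro j hj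
    by_cases hex : ∃ Q ∈ S, j ∈ Finset.Ico Q.1 (Q.1 + Q.2)
    · obtain ⟨Q, hQ, hjQ⟩ := hex
      have hbj : b j = badPart 𝕜 f Q j := by
        refine Finset.sum_eq_single_of_mem Q hQ fun Q' hQ' hne => ?_
        rw [badPart, if_neg]
        intro hj'
        exact Finset.disjoint_left.1 (hdisj hQ hQ' hne.symm) hjQ hj'
      have hgj : g j = (Q.2 : 𝕜)⁻¹ • ∑ k ∈ Finset.Ico Q.1 (Q.1 + Q.2), f k := by
        rw [hg, Pi.sub_apply, hbj, badPart, if_pos hjQ, sub_sub_cancel]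
      have hpos : (0 : ℝ) < Q.2 := by exact_mod_cast (hS Q hQ).2.1
      rw [hgj]
      refine (norm_average_le f Q).trans ?_
      rw [inv_mul_le_iff₀ hpos]
      linarith [(hS Q hQ).2.2.2]
    · push Not at hex
      have hbj : b j = 0 := Finset.sum_eq_zero fun Q hQ => by rw [badPart, if_neg (hex Q hQ)]
      have := hgood j (Finset.mem_Ico.2 ⟨Nat.zero_le _, hj⟩) hex
      have hgj : g j = f j := by simp [hg, hbj]
      rw [hgj]
      linarith
  have hGood := hB g (a / 2) (by positivity) hgsup
  simp only [Real.rpow_one] at hGood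
  -- The union of the enlarged blocks.
  set E : Finset ℕ := S.biUnion fun Q => (Finset.range N).filter
    (fun i => Q.1 ≤ i + 3 * Q.2 ∧ i < Q.1 + 4 * Q.2) with hE
  have hEcard : a * (E.card : ℝ) ≤ 28 * F := by
    have h1 : (E.card : ℝ) ≤ ∑ Q ∈ S, 7 * (Q.2 : ℝ) := by
      have : E.card ≤ ∑ Q ∈ S, 7 * Q.2 := by
        refine Finset.card_biUnion_le.trans (Finset.sum_le_sum fun Q _ => ?_)
        calc _ ≤ (Finset.Ico (Q.1 - 3 * Q.2) (Q.1 + 4 * Q.2)).card := by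
              refine Finset.card_le_card fun i hi => ?_
              simp only [Finset.mem_filter, Finset.mem_Ico] at hi ⊢
              omega
          _ ≤ 7 * Q.2 := by rw [Nat.card_Ico]; omega
      exact_mod_cast this
    calc a * (E.card : ℝ) ≤ a * ∑ Q ∈ S, 7 * (Q.2 : ℝ) := by gcongr
      _ = ∑ Q ∈ S, 28 * (a / 4 * Q.2) := by
          rw [Finset.mul_sum]
          exact Finset.sum_congr rfl fun Q _ => by ring
      _ ≤ ∑ Q ∈ S, 28 * ∑ j ∈ Finset.Ico Q.1 (Q.1 + Q.2), ‖f j‖ :=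
          Finset.sum_le_sum fun Q hQ => by linarith [(hS Q hQ).2.2.1]
      _ ≤ 28 * F := by
          rw [← Finset.mul_sum]
          linarith
  have hoff : ∑ i ∈ Finset.range N \ E, ‖matApply N A b i‖ ≤ 2 * F := by
    calc ∑ i ∈ Finset.range N \ E, ‖matApply N A b i‖
        ≤ ∑ i ∈ Finset.range N \ E, ∑ Q ∈ S, ‖matApply N A (badPart 𝕜 f Q) i‖ := by
          refine Finset.sum_le_sum fun i _ => ?_
          rw [hb, matApply_sum]
          exact norm_sum_le _ _
      _ = ∑ Q ∈ S, ∑ i ∈ Finset.range N \ E, ‖matApply N A (badPart 𝕜 f Q) i‖ := Finset.sum_comm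
      _ ≤ ∑ Q ∈ S, 2 * ∑ j ∈ Finset.Ico Q.1 (Q.1 + Q.2), ‖f j‖ := by
          refine Finset.sum_le_sum fun Q hQ => ?_
          refine le_trans ?_ (sum_norm_matApply_badPart_le hH f Q (hS Q hQ).2.1 (hS Q hQ).1)
          refine Finset.sum_le_sum_of_subset_of_nonneg ?_ fun _ _ _ => norm_nonneg _
          intro i hi
          rw [Finset.mem_sdiff] at hi
          refine Finset.mem_filter.2 ⟨hi.1, fun hc => hi.2 ?_⟩
          exact Finset.mem_biUnion.2 ⟨Q, hQ, Finset.mem_filter.2 ⟨hi.1, hc⟩⟩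
      _ ≤ 2 * F := by
          rw [← Finset.mul_sum]
          linarith
  have hBad : a / 2 * ((Finset.range N).filter fun i => a / 2 < ‖matApply N A b i‖).card ≤
      16 * F := by
    have h1 : ((Finset.range N).filter fun i => a / 2 < ‖matApply N A b i‖).card ≤
        E.card + ((Finset.range N \ E).filter fun i => a / 2 < ‖matApply N A b i‖).card := by
      refine (Finset.card_le_card ?_).trans (Finset.card_union_le _ _)
      intro i hi
      simp only [Finset.mem_filter, Finset.mem_union, Finset.mem_sdiff] at hi ⊢
      by_cases h : i ∈ E
      · exact Or.inl h
      · exact Or.inr ⟨⟨hi.1, h⟩, hi.2⟩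
    have h2 := mul_card_level_le (Finset.range N \ E) (fun i => ‖matApply N A b i‖)
      (fun i => norm_nonneg _) (a / 2)
    have h3 : (((Finset.range N).filter fun i => a / 2 < ‖matApply N A b i‖).card : ℝ) ≤
        E.card + ((Finset.range N \ E).filter fun i => a / 2 < ‖matApply N A b i‖).card := by
      exact_mod_cast h1
    nlinarith
  have hfin := card_level_add_le N A g b a
  rw [← hfgb] at hfin
  have hfin' : (((Finset.range N).filter fun i => a < ‖matApply N A f i‖).card : ℝ) ≤
      ((Finset.range N).filter fun i => a / 2 < ‖matApply N A g i‖).card +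
      ((Finset.range N).filter fun i => a / 2 < ‖matApply N A b i‖).card := by
    exact_mod_cast hfin
  nlinarith

end Matrices

section Interpolation

variable {𝕜 X Y : Type*} [RCLike 𝕜]
  [NormedAddCommGroup X] [NormedSpace 𝕜 X] [NormedAddCommGroup Y] [NormedSpace 𝕜 Y]

/-! ### Interpolation -/

/-- Chebyshev's inequality for finite sums of powers. -/
lemma rpow_mul_card_level_le (s : Finset ℕ) (u : ℕ → ℝ) (hu : ∀ i, 0 ≤ u i) {a r : ℝ}
    (ha : 0 ≤ a) (hr : 0 < r) :
    a ^ r * (s.filter fun i => a < u i).card ≤ ∑ i ∈ s, u i ^ r := by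
  have h := mul_card_level_le s (fun i => u i ^ r) (fun i => Real.rpow_nonneg (hu i) _) (a ^ r)
  simpa only [Real.rpow_lt_rpow_iff ha (hu _) hr] using h

/-- At a level `a ≥ ‖f j‖`, Chebyshev's inequality with the exponent `r` is brought down to `q` by
`‖f j‖ ^ r ≤ a ^ (r - q) * ‖f j‖ ^ q`. -/
lemma StrongBound.heightBound {N : ℕ} {A : ℕ → ℕ → X →L[𝕜] Y} {q r : ℝ} (hq : 1 ≤ q)
    (hqr : q ≤ r) (h : StrongBound N A r 1) : HeightBound N A q := by
  intro f a ha hf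
  have hr : 0 < r := by linarith
  have h1 := (rpow_mul_card_level_le (Finset.range N) (fun i => ‖matApply N A f i‖)
    (fun i => norm_nonneg _) ha.le hr).trans (h f)
  rw [Real.one_rpow, one_mul] at h1
  have h2 : ∑ j ∈ Finset.range N, ‖f j‖ ^ r ≤
      a ^ (r - q) * ∑ j ∈ Finset.range N, ‖f j‖ ^ q := by
    rw [Finset.mul_sum]
    refine Finset.sum_le_sum fun j hj => ?_
    have e : ‖f j‖ ^ r = ‖f j‖ ^ (r - q) * ‖f j‖ ^ q := by
      rw [← Real.rpow_add_of_nonneg (norm_nonneg _) (by linarith) (by linarith), sub_add_cancel]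
    rw [e]
    gcongr
    exact hf j (Finset.mem_range.1 hj)
  have e : a ^ r = a ^ (r - q) * a ^ q := by
    rw [← Real.rpow_add ha, sub_add_cancel]
  rw [e, mul_assoc] at h1
  exact le_of_mul_le_mul_left (h1.trans h2) (Real.rpow_pos_of_pos ha _)

/-- A matrix with sup bound `1` does not exceed a level dominating the sequence. -/
lemma SupBound.heightBound {N : ℕ} {A : ℕ → ℕ → X →L[𝕜] Y} {q : ℝ} (h : SupBound N A 1) :
    HeightBound N A q := by
  intro f a ha hf
  have h0 : (Finset.range N).filter (fun i => a < ‖matApply N A f i‖) = ∅ := by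
    refine Finset.filter_eq_empty_iff.2 fun i hi => ?_
    have := h f a hf i (Finset.mem_range.1 hi)
    rw [one_mul] at this
    exact not_lt.2 this
  rw [h0, Finset.card_empty, Nat.cast_zero, mul_zero]
  exact Finset.sum_nonneg fun j _ => Real.rpow_nonneg (norm_nonneg _) _

/-- The layer cake formula for finite sums. -/
lemma sum_rpow_eq_lintegral_card (s : Finset ℕ) (u : ℕ → ℝ) (hu : ∀ i, 0 ≤ u i) {p : ℝ}
    (hp : 0 < p) :
    ENNReal.ofReal (∑ i ∈ s, u i ^ p) = ENNReal.ofReal p *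
      ∫⁻ a in Ioi (0 : ℝ), ENNReal.ofReal ((s.filter fun i => a < u i).card * a ^ (p - 1)) := by
  have h := lintegral_rpow_eq_lintegral_meas_lt_mul (Measure.count.restrict (s : Set ℕ))
    (f := u) (Filter.Eventually.of_forall hu) (measurable_from_nat.aemeasurable) hp
  rw [lintegral_finset] at h
  simp only [Measure.count_singleton, mul_one] at h
  rw [ENNReal.ofReal_sum_of_nonneg fun i _ => Real.rpow_nonneg (hu i) _, h]
  congr 1
  refine lintegral_congr fun a => ?_
  rw [Measure.restrict_apply (MeasurableSet.of_discrete), ENNReal.ofReal_mul (Nat.cast_nonneg _),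
    ENNReal.ofReal_natCast]
  congr 1
  have e : {x | a < u x} ∩ (s : Set ℕ) = ((s.filter fun i => a < u i : Finset ℕ) : Set ℕ) := by
    ext i
    simp [and_comm]
  rw [e, Measure.count_apply_finset]

/-- The contribution of a single entry of size `c / 2` to the interpolated bound. -/
lemma lintegral_truncation {C c p q : ℝ} (hC : 0 ≤ C) (hc : 0 ≤ c) (hp : 1 < p) (hpq : p < q) :
    ∫⁻ a in Ioi (0 : ℝ), ENNReal.ofReal
      (if a ≤ c then C * c * a ^ (p - 2) else c ^ q * a ^ (p - 1 - q)) =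
      ENNReal.ofReal ((C / (p - 1) + 1 / (q - p)) * c ^ p) := by
  rcases hc.eq_or_lt with rfl | hc0
  · rw [Real.zero_rpow (show p ≠ 0 by linarith), mul_zero (C / _ + _), ENNReal.ofReal_zero]
    rw [setLIntegral_congr_fun (g := fun _ => 0) measurableSet_Ioi, lintegral_zero]
    intro a ha
    have : ¬ a ≤ 0 := not_le.2 ha
    simp [this, Real.zero_rpow (show q ≠ 0 by linarith)]
  rw [← Ioc_union_Ioi_eq_Ioi hc, lintegral_union measurableSet_Ioi (by
    rw [Set.disjoint_left]
    intro x hx hx'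
    exact absurd hx.2 (not_le.2 hx'))]
  have h1 : ∫⁻ a in Ioc 0 c, ENNReal.ofReal
      (if a ≤ c then C * c * a ^ (p - 2) else c ^ q * a ^ (p - 1 - q)) =
      ENNReal.ofReal (C / (p - 1) * c ^ p) := by
    have hi : IntegrableOn (fun a : ℝ => C * c * a ^ (p - 2)) (Ioc 0 c) := by
      have := intervalIntegral.intervalIntegrable_rpow' (a := 0) (b := c)
        (show -1 < p - 2 by linarith)
      exact ((intervalIntegrable_iff_integrableOn_Ioc_of_le hc).1 this).const_mul _
    rw [setLIntegral_congr_fun (g := fun a => ENNReal.ofReal (C * c * a ^ (p - 2)))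
      measurableSet_Ioc (fun a ha => by simp [ha.2])]
    rw [← ofReal_integral_eq_lintegral_ofReal hi]
    · rw [integral_const_mul, ← intervalIntegral.integral_of_le hc,
        integral_rpow (Or.inl (by linarith)), Real.zero_rpow (by linarith)]
      congr 1
      have e : c ^ p = c * c ^ (p - 1) := by
        rw [Real.rpow_sub_one hc0.ne']
        field_simp
      rw [e, show p - 2 + 1 = p - 1 by ring]
      ring
    · filter_upwards [ae_restrict_mem measurableSet_Ioc] with a ha
      have := ha.1
      positivity
  have h2 : ∫⁻ a in Ioi c, ENNReal.ofReal
      (if a ≤ c then C * c * a ^ (p - 2) else c ^ q * a ^ (p - 1 - q)) =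
      ENNReal.ofReal (1 / (q - p) * c ^ p) := by
    have hlt : p - 1 - q < -1 := by linarith
    have hi : IntegrableOn (fun a : ℝ => c ^ q * a ^ (p - 1 - q)) (Ioi c) :=
      (integrableOn_Ioi_rpow_of_lt hlt hc0).const_mul _
    rw [setLIntegral_congr_fun (g := fun a => ENNReal.ofReal (c ^ q * a ^ (p - 1 - q)))
      measurableSet_Ioi (fun a ha => by simp [not_le.2 (mem_Ioi.1 ha)])]
    rw [← ofReal_integral_eq_lintegral_ofReal hi]
    · rw [integral_const_mul, integral_Ioi_rpow_of_lt hlt hc0]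
      congr 1
      have e : c ^ p = c ^ q * c ^ (p - q) := by
        rw [← Real.rpow_add hc0]
        congr 1
        ring
      have hqp : q - p ≠ 0 := by linarith
      have hqp' : p - q ≠ 0 := by linarith
      rw [e, show p - 1 - q + 1 = p - q by ring, ← neg_sub p q]
      field_simp
    · filter_upwards [ae_restrict_mem measurableSet_Ioi] with a ha
      have : 0 < a := hc0.trans ha
      positivity
  rw [h1, h2, ← ENNReal.ofReal_add, add_mul]
  · have : 0 < p - 1 := by linarith
    positivity
  · have : 0 < q - p := by linarith
    positivity

/-- The constant of the interpolation between weak type `(1, 1)` with constant `38` and the exponent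
`q`. -/
noncomputable def interpConst (p q : ℝ) : ℝ :=
  (p * 2 ^ p * (38 / (p - 1) + 1 / (q - p))) ^ (1 / p)

/-- Marcinkiewicz interpolation. Truncating `f` at height `a / 2` when estimating the level set
`{‖A f‖ > a}` makes the `HeightBound` applicable to the small part. -/
theorem strongBound_of_weakOne {N : ℕ} {A : ℕ → ℕ → X →L[𝕜] Y} {p q : ℝ} (hp : 1 < p)
    (hpq : p < q) (h1 : WeakOne N A 38) (hq : HeightBound N A q) :
    StrongBound N A p (interpConst p q) := by
  intro f
  have hp1 : 0 < p - 1 := by linarith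
  have hqp : 0 < q - p := by linarith
  have hp0 : 0 < p := by linarith
  have hlevel : ∀ a : ℝ, 0 < a →
      (((Finset.range N).filter fun i => a < ‖matApply N A f i‖).card : ℝ) * a ^ (p - 1) ≤
      ∑ j ∈ Finset.range N, (if a ≤ 2 * ‖f j‖ then 38 * (2 * ‖f j‖) * a ^ (p - 2)
        else (2 * ‖f j‖) ^ q * a ^ (p - 1 - q)) := by
    intro a ha
    set F : ℕ → X := fun j => if a ≤ 2 * ‖f j‖ then f j else 0 with hF
    set G : ℕ → X := fun j => if a ≤ 2 * ‖f j‖ then 0 else f j with hG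
    have hFG : f = F + G := by
      ext j
      by_cases h : a ≤ 2 * ‖f j‖ <;> simp [hF, hG, h]
    have hcard := card_level_add_le N A F G a
    rw [← hFG] at hcard
    have hcard' : (((Finset.range N).filter fun i => a < ‖matApply N A f i‖).card : ℝ) ≤
        ((Finset.range N).filter fun i => a / 2 < ‖matApply N A F i‖).card +
        ((Finset.range N).filter fun i => a / 2 < ‖matApply N A G i‖).card := by
      exact_mod_cast hcard
    have hbig := h1 F (a / 2) (by positivity)
    have hsmall := hq G (a / 2) (by positivity) (by
      intro j _
      by_cases h : a ≤ 2 * ‖f j‖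
      · simp only [hG, h, if_true, norm_zero]
        positivity
      · simp only [hG, h, if_false]
        linarith)
    set nF : ℝ := (((Finset.range N).filter fun i => a / 2 < ‖matApply N A F i‖).card : ℝ)
    set nG : ℝ := (((Finset.range N).filter fun i => a / 2 < ‖matApply N A G i‖).card : ℝ)
    have eF : nF * a ^ (p - 1) ≤ ∑ j ∈ Finset.range N, 38 * (2 * ‖F j‖) * a ^ (p - 2) := by
      have e : a ^ (p - 1) = a * a ^ (p - 2) := by
        rw [show p - 1 = 1 + (p - 2) by ring, Real.rpow_add ha, Real.rpow_one]
      calc nF * a ^ (p - 1) = 2 * (a / 2 * nF) * a ^ (p - 2) := by rw [e]; ring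
        _ ≤ 2 * (38 * ∑ j ∈ Finset.range N, ‖F j‖) * a ^ (p - 2) := by gcongr
        _ = _ := by
          rw [Finset.mul_sum, Finset.mul_sum, Finset.sum_mul]
          exact Finset.sum_congr rfl fun j _ => by ring
    have eG : nG * a ^ (p - 1) ≤ ∑ j ∈ Finset.range N, (2 * ‖G j‖) ^ q * a ^ (p - 1 - q) := by
      have e : a ^ (p - 1) = (a / 2) ^ q * 2 ^ q * a ^ (p - 1 - q) := by
        rw [← Real.mul_rpow (by positivity) (by positivity), div_mul_cancel₀ _ (by norm_num),
          ← Real.rpow_add ha]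
        congr 1
        ring
      calc nG * a ^ (p - 1) = ((a / 2) ^ q * nG) * (2 ^ q * a ^ (p - 1 - q)) := by rw [e]; ring
        _ ≤ (∑ j ∈ Finset.range N, ‖G j‖ ^ q) * (2 ^ q * a ^ (p - 1 - q)) := by gcongr
        _ = _ := by
          rw [Finset.sum_mul]
          refine Finset.sum_congr rfl fun j _ => ?_
          rw [Real.mul_rpow (by norm_num) (norm_nonneg _)]
          ring
    calc _ ≤ (nF + nG) * a ^ (p - 1) := by gcongr
      _ = nF * a ^ (p - 1) + nG * a ^ (p - 1) := by ring
      _ ≤ _ := add_le_add eF eG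
      _ = _ := by
        rw [← Finset.sum_add_distrib]
        refine Finset.sum_congr rfl fun j _ => ?_
        by_cases h : a ≤ 2 * ‖f j‖
        · simp [hF, hG, h, Real.zero_rpow (show q ≠ 0 by linarith)]
        · simp [hF, hG, h]
  have hK : 0 ≤ 38 / (p - 1) + 1 / (q - p) := by positivity
  have key : ENNReal.ofReal (∑ i ∈ Finset.range N, ‖matApply N A f i‖ ^ p) ≤
      ENNReal.ofReal (p * ∑ j ∈ Finset.range N,
        (38 / (p - 1) + 1 / (q - p)) * (2 * ‖f j‖) ^ p) := by
    rw [sum_rpow_eq_lintegral_card _ _ (fun i => norm_nonneg _) hp0, ENNReal.ofReal_mul hp0.le]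
    gcongr
    calc _ ≤ ∫⁻ a in Ioi (0 : ℝ), ∑ j ∈ Finset.range N, ENNReal.ofReal
          (if a ≤ 2 * ‖f j‖ then 38 * (2 * ‖f j‖) * a ^ (p - 2)
            else (2 * ‖f j‖) ^ q * a ^ (p - 1 - q)) := by
          refine setLIntegral_mono' measurableSet_Ioi fun a ha => ?_
          have ha' : 0 < a := ha
          rw [← ENNReal.ofReal_sum_of_nonneg]
          · exact ENNReal.ofReal_le_ofReal (hlevel a ha)
          · intro j _
            split_ifs <;> positivity
      _ = ∑ j ∈ Finset.range N, ENNReal.ofReal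
          ((38 / (p - 1) + 1 / (q - p)) * (2 * ‖f j‖) ^ p) := by
          rw [lintegral_finsetSum']
          · exact Finset.sum_congr rfl fun j _ =>
              lintegral_truncation (by norm_num) (by positivity) hp hpq
          · intro j _
            refine (Measurable.ennreal_ofReal ?_).aemeasurable
            exact Measurable.ite measurableSet_Iic (by fun_prop) (by fun_prop)
      _ = _ := (ENNReal.ofReal_sum_of_nonneg fun j _ => by positivity).symm
  rw [ENNReal.ofReal_le_ofReal_iff (mul_nonneg hp0.le
    (Finset.sum_nonneg fun j _ => by positivity))] at key
  refine key.trans (le_of_eq ?_)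
  rw [interpConst, ← Real.rpow_mul (by positivity), one_div_mul_cancel hp0.ne', Real.rpow_one,
    Finset.mul_sum, Finset.mul_sum]
  refine Finset.sum_congr rfl fun j _ => ?_
  rw [Real.mul_rpow (by norm_num) (norm_nonneg _)]
  ring

end Interpolation

section Duality

variable {𝕜 X Y : Type*} [RCLike 𝕜]
  [NormedAddCommGroup X] [NormedSpace 𝕜 X] [NormedAddCommGroup Y] [NormedSpace 𝕜 Y]

/-! ### Duality for operator matrices -/

/-- The transposed matrix of the (Banach space) adjoints of the entries. -/
noncomputable def dualMatrix (A : ℕ → ℕ → X →L[𝕜] Y) (j i : ℕ) :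
    StrongDual 𝕜 Y →L[𝕜] StrongDual 𝕜 X :=
  (ContinuousLinearMap.compL 𝕜 X Y 𝕜).flip (A i j)

lemma dualMatrix_apply (A : ℕ → ℕ → X →L[𝕜] Y) (j i : ℕ) (g : StrongDual 𝕜 Y) (x : X) :
    dualMatrix A j i g x = g (A i j x) := rfl

lemma norm_dualMatrix_sub_le (A : ℕ → ℕ → X →L[𝕜] Y) (j j' i i' : ℕ) :
    ‖dualMatrix A j i - dualMatrix A j' i'‖ ≤ ‖A i j - A i' j'‖ := by
  refine ContinuousLinearMap.opNorm_le_bound _ (norm_nonneg _) fun g => ?_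
  have : (dualMatrix A j i - dualMatrix A j' i') g = g.comp (A i j - A i' j') := by
    ext x
    simp [dualMatrix_apply]
  rw [this, mul_comm]
  exact ContinuousLinearMap.opNorm_comp_le _ _

lemma matApply_dualMatrix (N : ℕ) (A : ℕ → ℕ → X →L[𝕜] Y) (g : ℕ → StrongDual 𝕜 Y)
    (f : ℕ → X) :
    ∑ j ∈ Finset.range N, matApply N (dualMatrix A) g j (f j) =
      ∑ i ∈ Finset.range N, g i (matApply N A f i) := by
  simp only [matApply, map_sum, sum_apply, dualMatrix_apply]
  exact Finset.sum_comm

/-- A functional nearly attains its norm, with a nonnegative value. -/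
lemma exists_nearly_norming (h : StrongDual 𝕜 X) {θ : ℝ} (hθ : θ < 1) :
    ∃ x : X, ‖x‖ ≤ 1 ∧ ∃ v : ℝ, θ * ‖h‖ ≤ v ∧ h x = (v : 𝕜) := by
  rcases (norm_nonneg h).eq_or_lt with h0 | h0
  · exact ⟨0, by simp, 0, by simp [← h0], by simp⟩
  obtain ⟨x, hx, hx'⟩ := ContinuousLinearMap.exists_lt_apply_of_lt_opNorm h
    (show θ * ‖h‖ < ‖h‖ by nlinarith)
  obtain ⟨c, hc, hc'⟩ := RCLike.exists_norm_eq_mul_self (h x)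
  refine ⟨c • x, ?_, ‖h x‖, hx'.le, ?_⟩
  · rw [norm_smul, hc, one_mul]
    exact hx.le
  · rw [map_smul, smul_eq_mul, hc']

/-- A strong type bound passes to the dual matrix, with the conjugate exponent. -/
theorem StrongBound.dualMatrix {N : ℕ} {A : ℕ → ℕ → X →L[𝕜] Y} {p q c : ℝ}
    (hpq : p.HolderConjugate q) (hc : 0 ≤ c) (hA : StrongBound N A p c) :
    StrongBound N (dualMatrix A) q c := by
  intro g
  have hp0 := hpq.pos
  have hq0 := hpq.symm.pos
  set h := matApply N (_root_.dualMatrix A) g with hh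
  set H := ∑ j ∈ Finset.range N, ‖h j‖ ^ q with hH
  set G := ∑ i ∈ Finset.range N, ‖g i‖ ^ q with hG
  have hH0 : 0 ≤ H := Finset.sum_nonneg fun j _ => by positivity
  have hG0 : 0 ≤ G := Finset.sum_nonneg fun j _ => by positivity
  have key : ∀ θ : ℝ, θ < 1 → θ * H ≤ c * G ^ (1 / q) * H ^ (1 / p) := by
    intro θ hθ
    choose x hx v hv hxv using fun j => exists_nearly_norming (h j) hθ
    set f : ℕ → X := fun j => ((‖h j‖ ^ (q - 1) : ℝ) : 𝕜) • x j with hf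
    have hfn : ∀ j, ‖f j‖ ^ p ≤ ‖h j‖ ^ q := by
      intro j
      have h1 : ‖f j‖ ≤ ‖h j‖ ^ (q - 1) := by
        rw [hf, norm_smul, RCLike.norm_ofReal, abs_of_nonneg (by positivity)]
        exact mul_le_of_le_one_right (by positivity) (hx j)
      calc ‖f j‖ ^ p ≤ (‖h j‖ ^ (q - 1)) ^ p := by gcongr
        _ = ‖h j‖ ^ q := by
          rw [← Real.rpow_mul (norm_nonneg _), hpq.symm.sub_one_mul_conj]
    have e1 : ∑ j ∈ Finset.range N, h j (f j) =
        ((∑ j ∈ Finset.range N, ‖h j‖ ^ (q - 1) * v j : ℝ) : 𝕜) := by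
      push_cast
      refine Finset.sum_congr rfl fun j _ => ?_
      rw [hf, map_smul, smul_eq_mul, hxv]
    have e2 : θ * H ≤ ∑ j ∈ Finset.range N, ‖h j‖ ^ (q - 1) * v j := by
      rw [hH, Finset.mul_sum]
      refine Finset.sum_le_sum fun j _ => ?_
      have e : ‖h j‖ ^ q = ‖h j‖ ^ (q - 1) * ‖h j‖ := by
        conv_rhs => rw [← Real.rpow_one ‖h j‖]
        rw [Real.rpow_one, ← Real.rpow_add_one' (norm_nonneg _) (by linarith), sub_add_cancel]
      calc θ * ‖h j‖ ^ q = ‖h j‖ ^ (q - 1) * (θ * ‖h j‖) := by rw [e]; ring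
        _ ≤ _ := by
          gcongr
          exact hv j
    have e3 : ∑ j ∈ Finset.range N, ‖h j‖ ^ (q - 1) * v j ≤
        ∑ i ∈ Finset.range N, ‖g i‖ * ‖matApply N A f i‖ := by
      calc ∑ j ∈ Finset.range N, ‖h j‖ ^ (q - 1) * v j
          ≤ ‖((∑ j ∈ Finset.range N, ‖h j‖ ^ (q - 1) * v j : ℝ) : 𝕜)‖ := by
            rw [RCLike.norm_ofReal]
            exact le_abs_self _
        _ = ‖∑ i ∈ Finset.range N, g i (matApply N A f i)‖ := by
            rw [← e1, matApply_dualMatrix]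
        _ ≤ _ := (norm_sum_le _ _).trans (Finset.sum_le_sum fun i _ =>
            ContinuousLinearMap.le_opNorm _ _)
    have e4 := Real.inner_le_Lp_mul_Lq_of_nonneg (Finset.range N) hpq.symm
      (f := fun i => ‖g i‖) (g := fun i => ‖matApply N A f i‖)
      (fun i _ => norm_nonneg _) (fun i _ => norm_nonneg _)
    have e5 : (∑ i ∈ Finset.range N, ‖matApply N A f i‖ ^ p) ^ (1 / p) ≤ c * H ^ (1 / p) := by
      calc (∑ i ∈ Finset.range N, ‖matApply N A f i‖ ^ p) ^ (1 / p)
          ≤ (c ^ p * H) ^ (1 / p) := by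
            refine Real.rpow_le_rpow (Finset.sum_nonneg fun j _ => by positivity) ?_ (by positivity)
            refine (hA f).trans ?_
            gcongr
            exact Finset.sum_le_sum fun j _ => hfn j
        _ = c * H ^ (1 / p) := by
            rw [Real.mul_rpow (by positivity) hH0, ← Real.rpow_mul hc, mul_one_div_cancel hp0.ne',
              Real.rpow_one]
    calc θ * H ≤ _ := e2.trans (e3.trans e4)
      _ ≤ G ^ (1 / q) * (c * H ^ (1 / p)) := by gcongr
      _ = _ := by ring
  have key1 : H ≤ c * G ^ (1 / q) * H ^ (1 / p) := by
    refine le_of_forall_pos_le_add fun ε hε => ?_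
    rcases hH0.eq_or_lt with h0 | h0
    · rw [← h0]
      positivity
    · have := key (1 - ε / H) (by linarith [div_pos hε h0])
      rw [sub_mul, one_mul, div_mul_cancel₀ _ h0.ne'] at this
      linarith
  rcases hH0.eq_or_lt with h0 | h0
  · rw [← h0]
    positivity
  have key2 : H ^ (1 / q) ≤ c * G ^ (1 / q) := by
    have e : H = H ^ (1 / q) * H ^ (1 / p) := by
      rw [← Real.rpow_add h0, one_div, one_div, hpq.symm.inv_add_inv_eq_one, Real.rpow_one]
    have hpos : 0 < H ^ (1 / p) := by positivity
    refine le_of_mul_le_mul_right ?_ hpos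
    rw [← e]
    exact key1
  calc H = (H ^ (1 / q)) ^ q := by
        rw [← Real.rpow_mul hH0, one_div_mul_cancel hq0.ne', Real.rpow_one]
    _ ≤ (c * G ^ (1 / q)) ^ q := by gcongr
    _ = c ^ q * G := by
        rw [Real.mul_rpow hc (by positivity), ← Real.rpow_mul hG0, one_div_mul_cancel hq0.ne',
          Real.rpow_one]

/-- The converse of `StrongBound.dualMatrix`, by passing to the bidual. -/
theorem StrongBound.of_dualMatrix {N : ℕ} {A : ℕ → ℕ → X →L[𝕜] Y} {p q c : ℝ}
    (hpq : p.HolderConjugate q) (hc : 0 ≤ c) (hA : StrongBound N (_root_.dualMatrix A) p c) :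
    StrongBound N A q c := by
  intro f
  have h := hA.dualMatrix hpq hc fun j => NormedSpace.inclusionInDoubleDual 𝕜 X (f j)
  have e : ∀ i, matApply N (_root_.dualMatrix (_root_.dualMatrix A))
      (fun j => NormedSpace.inclusionInDoubleDual 𝕜 X (f j)) i =
      NormedSpace.inclusionInDoubleDual 𝕜 Y (matApply N A f i) := by
    intro i
    rw [matApply, matApply, map_sum]
    rfl
  have hX : ∀ x : X, ‖NormedSpace.inclusionInDoubleDual 𝕜 X x‖ = ‖x‖ :=
    (NormedSpace.inclusionInDoubleDualLi 𝕜 (E := X)).norm_map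
  have hY : ∀ y : Y, ‖NormedSpace.inclusionInDoubleDual 𝕜 Y y‖ = ‖y‖ :=
    (NormedSpace.inclusionInDoubleDualLi 𝕜 (E := Y)).norm_map
  simpa only [e, hX, hY] using h

/-! ### Bounds for matrices of Calderón–Zygmund type -/

lemma StrongBound.mono {N : ℕ} {A : ℕ → ℕ → X →L[𝕜] Y} {p c c' : ℝ} (hp : 0 ≤ p) (hc : 0 ≤ c)
    (hcc' : c ≤ c') (h : StrongBound N A p c) : StrongBound N A p c' := by
  intro f
  refine (h f).trans ?_
  have : 0 ≤ ∑ j ∈ Finset.range N, ‖f j‖ ^ p := Finset.sum_nonneg fun j _ => by positivity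
  gcongr

lemma norm_matApply_smul (N : ℕ) (A : ℕ → ℕ → X →L[𝕜] Y) {t : ℝ} (ht : 0 ≤ t) (f : ℕ → X)
    (i : ℕ) : ‖matApply N (fun i j => (t : 𝕜) • A i j) f i‖ = t * ‖matApply N A f i‖ := by
  have : matApply N (fun i j => (t : 𝕜) • A i j) f i = (t : 𝕜) • matApply N A f i := by
    simp [matApply, Finset.smul_sum]
  rw [this, norm_smul, RCLike.norm_ofReal, abs_of_nonneg ht]

lemma strongBound_smul_iff {N : ℕ} {A : ℕ → ℕ → X →L[𝕜] Y} {p c t : ℝ} (hc : 0 ≤ c) (ht : 0 < t) :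
    StrongBound N (fun i j => (t : 𝕜) • A i j) p (t * c) ↔ StrongBound N A p c := by
  refine forall_congr' fun f => ?_
  simp only [norm_matApply_smul N A ht.le, Real.mul_rpow ht.le (norm_nonneg _),
    Real.mul_rpow ht.le hc, ← Finset.mul_sum]
  rw [mul_assoc]
  exact mul_le_mul_iff_right₀ (Real.rpow_pos_of_pos ht _)

lemma SupBound.smul {N : ℕ} {A : ℕ → ℕ → X →L[𝕜] Y} {c t : ℝ} (ht : 0 ≤ t)
    (h : SupBound N A c) : SupBound N (fun i j => (t : 𝕜) • A i j) (t * c) := by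
  intro f R hf i hi
  rw [norm_matApply_smul N A ht, mul_assoc]
  gcongr
  exact h f R hf i hi

lemma weakOne_of_smul {N : ℕ} {A : ℕ → ℕ → X →L[𝕜] Y} {c t : ℝ} (ht : 0 < t)
    (h : WeakOne N (fun i j => (t : 𝕜) • A i j) (t * c)) : WeakOne N A c := by
  intro f a ha
  have := h f (t * a) (by positivity)
  simp only [norm_matApply_smul N A ht.le, mul_lt_mul_iff_right₀ ht, mul_assoc] at this
  exact le_of_mul_le_mul_left this ht

lemma Hormander.smul {N : ℕ} {A : ℕ → ℕ → X →L[𝕜] Y} {c t : ℝ} (ht : 0 ≤ t)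
    (h : Hormander N A c) : Hormander N (fun i j => (t : 𝕜) • A i j) (t * c) := by
  intro a ℓ j h1 h2 h3
  have e : ∀ i, ‖(t : 𝕜) • A i j - (t : 𝕜) • A i a‖ = t * ‖A i j - A i a‖ := by
    intro i
    rw [← smul_sub, norm_smul, RCLike.norm_ofReal, abs_of_nonneg ht]
  simp only [e, ← Finset.mul_sum]
  gcongr
  exact h a ℓ j h1 h2 h3

lemma Hormander.mono {N : ℕ} {A : ℕ → ℕ → X →L[𝕜] Y} {c c' : ℝ} (hcc' : c ≤ c')
    (h : Hormander N A c) : Hormander N A c' :=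
  fun a ℓ j h1 h2 h3 => (h a ℓ j h1 h2 h3).trans hcc'

lemma dualMatrix_smul (A : ℕ → ℕ → X →L[𝕜] Y) (t : 𝕜) :
    dualMatrix (fun i j => t • A i j) = fun j i => t • dualMatrix A j i := by
  ext j i g x
  simp [dualMatrix_apply]

/-- The exponent conjugate to `p`. -/
noncomputable def conjExp (p : ℝ) : ℝ := p / (p - 1)

/-- The constant of the strong type `(p, p)` bound of a normalised matrix: the maximum of those
obtained by interpolating directly and by way of the dual matrix. -/
noncomputable def czConst (p : ℝ) : ℝ :=
  max (interpConst p (2 * p))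
    (max 1 (interpConst (conjExp (4 * p)) (conjExp (2 * p))) * interpConst p (4 * p))

lemma interpConst_nonneg {p q : ℝ} (hp : 1 < p) (hpq : p < q) : 0 ≤ interpConst p q := by
  have h1 : 0 < p - 1 := by linarith
  have h2 : 0 < q - p := by linarith
  rw [interpConst]
  positivity

lemma conjExp_anti {p q : ℝ} (hp : 1 < p) (hpq : p ≤ q) : conjExp q ≤ conjExp p := by
  rw [conjExp, conjExp, div_le_div_iff₀ (by linarith) (by linarith)]
  nlinarith

/-- The `L^p` bound with a constant independent of `r`. If `r ≥ 2p`, interpolation between `1` and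
`2p` is enough. Otherwise the dual matrix is bounded with the exponent conjugate to `r`, hence by
interpolation with the exponent conjugate to `4p`, which gives the bound for `4p` to interpolate
with. -/
theorem strongBound_of_hormander {L : ℕ} {A : ℕ → ℕ → X →L[𝕜] Y} (hH : Hormander (2 ^ L) A 1)
    (hH' : Hormander (2 ^ L) (dualMatrix A) 1) {r : ℝ≥0∞} (hr : 1 < r)
    (hsup : r = ∞ → SupBound (2 ^ L) A 1) (hA : r ≠ ∞ → StrongBound (2 ^ L) A r.toReal 1) :
    WeakOne (2 ^ L) A 38 ∧ ∀ p : ℝ, 1 < p → StrongBound (2 ^ L) A p (czConst p) := by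
  by_cases hrt : r = ∞
  · have hW := weakOne_of_hormander hH (hsup hrt).heightBound
    refine ⟨hW, fun p hp => ?_⟩
    exact (strongBound_of_weakOne hp (by linarith) hW (hsup hrt).heightBound).mono (by linarith)
      (interpConst_nonneg hp (by linarith)) (le_max_left _ _)
  have hA := hA hrt
  have hr1 : 1 < r.toReal := by
    rw [← ENNReal.toReal_one]
    exact (ENNReal.toReal_lt_toReal ENNReal.one_ne_top hrt).2 hr
  set s := r.toReal
  have hW := weakOne_of_hormander hH (hA.heightBound le_rfl hr1.le)
  refine ⟨hW, fun p hp => ?_⟩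
  by_cases hrp : 2 * p ≤ s
  · exact (strongBound_of_weakOne hp (by linarith) hW (hA.heightBound (by linarith) hrp)).mono
      (by linarith) (interpConst_nonneg hp (by linarith)) (le_max_left _ _)
  push Not at hrp
  have hD := hA.dualMatrix (Real.HolderConjugate.conjExponent hr1) zero_le_one
  have hs' : 1 < conjExp s := (Real.HolderConjugate.conjExponent hr1).symm.lt
  have h2p : 1 < conjExp (2 * p) := (Real.HolderConjugate.conjExponent (by linarith)).symm.lt
  have h4 := Real.HolderConjugate.conjExponent (show 1 < 4 * p by linarith)
  have h4p : 1 < conjExp (4 * p) := h4.symm.lt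
  have hlt : conjExp (4 * p) < conjExp (2 * p) := by
    rw [conjExp, conjExp, div_lt_div_iff₀ (by linarith) (by linarith)]
    nlinarith
  have hDW := weakOne_of_hormander hH' (hD.heightBound le_rfl hs'.le)
  have hD4 := strongBound_of_weakOne h4p hlt hDW
    (hD.heightBound h2p.le (conjExp_anti hr1 hrp.le))
  set d := interpConst (conjExp (4 * p)) (conjExp (2 * p)) with hd
  have hd0 : 0 ≤ d := interpConst_nonneg h4p hlt
  have hA4 : StrongBound (2 ^ L) A (4 * p) (max 1 d) :=
    (hD4.of_dualMatrix h4.symm hd0).mono (by linarith) hd0 (le_max_right _ _)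
  have hm : 0 < max 1 d := by positivity
  have ht : 0 < (max 1 d)⁻¹ := by positivity
  have ht1 : (max 1 d)⁻¹ ≤ 1 := inv_le_one_of_one_le₀ (le_max_left _ _)
  -- Normalise the bound for `4p`; the other normalisations survive.
  set A' : ℕ → ℕ → X →L[𝕜] Y := fun i j => (((max 1 d)⁻¹ : ℝ) : 𝕜) • A i j with hA'
  have hA'4 : StrongBound (2 ^ L) A' (4 * p) 1 := by
    rw [← inv_mul_cancel₀ hm.ne']
    exact (strongBound_smul_iff hm.le ht).2 hA4
  have hH1 : Hormander (2 ^ L) A' 1 := (hH.smul ht.le).mono (by simpa using ht1)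
  have hW' := weakOne_of_hormander hH1 (hA'4.heightBound le_rfl (by linarith))
  have h0 := interpConst_nonneg hp (show p < 4 * p by linarith)
  have hp' := strongBound_of_weakOne hp (show p < 4 * p by linarith) hW'
    (hA'4.heightBound (by linarith) le_rfl)
  refine StrongBound.mono (by linarith) (by positivity) (le_max_right _ _) ?_
  refine (strongBound_smul_iff (by positivity) ht).1 ?_
  rwa [← mul_assoc, inv_mul_cancel₀ hm.ne', one_mul]

/-- The bounds for a matrix whose operator norm and Hörmander constants are at most `κ`. -/
theorem bounds_of_hormander {L : ℕ} {A : ℕ → ℕ → X →L[𝕜] Y} {κ : ℝ} (hκ : 0 ≤ κ)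
    (hH : Hormander (2 ^ L) A κ)
    (hH' : Hormander (2 ^ L) (dualMatrix A) κ) {r : ℝ≥0∞} (hr : 1 < r)
    (hsup : r = ∞ → SupBound (2 ^ L) A κ) (hA : r ≠ ∞ → StrongBound (2 ^ L) A r.toReal κ) :
    WeakOne (2 ^ L) A (38 * κ) ∧
      ∀ p : ℝ, 1 < p → StrongBound (2 ^ L) A p (czConst p * κ) := by
  rcases hκ.eq_or_lt with rfl | hκ
  -- For `κ = 0` there is nothing to normalise, and the matrix vanishes.
  · have h0 : ∀ f, ∀ i < 2 ^ L, ‖matApply (2 ^ L) A f i‖ = 0 := by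
      intro f i hi
      by_cases hrt : r = ∞
      · obtain ⟨R, hR⟩ := ((Finset.range (2 ^ L)).image fun j => ‖f j‖).bddAbove
        have := hsup hrt f R (fun j hj => hR (by
          simp only [Finset.coe_image, Finset.coe_range]
          exact ⟨j, hj, rfl⟩)) i hi
        rw [zero_mul] at this
        exact le_antisymm this (norm_nonneg _)
      · have hr0 : 0 < r.toReal := ENNReal.toReal_pos (by positivity) hrt
        have := hA hrt f
        rw [Real.zero_rpow hr0.ne', zero_mul] at this
        have h1 := (Finset.single_le_sum (f := fun i => ‖matApply (2 ^ L) A f i‖ ^ r.toReal)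
          (fun i _ => by positivity) (Finset.mem_range.2 hi)).trans this
        have h2 := le_antisymm h1 (by positivity)
        exact (Real.rpow_eq_zero (norm_nonneg _) hr0.ne').1 h2
    constructor
    · intro f a ha
      have : (Finset.range (2 ^ L)).filter (fun i => a < ‖matApply (2 ^ L) A f i‖) = ∅ := by
        refine Finset.filter_eq_empty_iff.2 fun i hi => ?_
        rw [h0 f i (Finset.mem_range.1 hi)]
        exact not_lt.2 ha.le
      simp [this]
    · intro p hp f
      have hp0 : p ≠ 0 := by linarith
      rw [mul_zero, Real.zero_rpow hp0, zero_mul]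
      refine (Finset.sum_eq_zero fun i hi => ?_).le
      rw [h0 f i (Finset.mem_range.1 hi), Real.zero_rpow hp0]
  have ht : 0 < κ⁻¹ := by positivity
  have hone : κ⁻¹ * κ = 1 := inv_mul_cancel₀ hκ.ne'
  have hH1 := hH.smul ht.le
  have hH2 := hH'.smul ht.le
  rw [hone] at hH1 hH2
  rw [← dualMatrix_smul] at hH2
  obtain ⟨hW, hS⟩ := strongBound_of_hormander hH1 hH2 hr
    (fun h => by rw [← hone]; exact (hsup h).smul ht.le)
    (fun h => by rw [← hone]; exact (strongBound_smul_iff hκ.le ht).2 (hA h))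
  refine ⟨weakOne_of_smul ht ?_, fun p hp => ?_⟩
  · rwa [mul_comm, mul_assoc, mul_inv_cancel₀ hκ.ne', mul_one]
  · have hc : 0 ≤ czConst p :=
      (interpConst_nonneg hp (show p < 2 * p by linarith)).trans (le_max_left _ _)
    refine (strongBound_smul_iff (by positivity) ht).1 ?_
    rw [mul_comm, mul_assoc, mul_inv_cancel₀ hκ.ne', mul_one]
    exact hS p hp

end Duality

/-! ### Dyadic averages on the half-line -/

section Averages

variable {E : Type*} [NormedAddCommGroup E]

/-- The dyadic interval `[(j + 1) / 2ⁿ, (j + 2) / 2ⁿ)`. The shift of the index keeps the cells of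
each generation away from the origin, so that their closures are compact in the half-line. -/
def cell (n j : ℕ) : Set ℝ := Ico (((j : ℝ) + 1) / 2 ^ n) (((j : ℝ) + 2) / 2 ^ n)

/-- The step function with values `c j` on the cells `cell n j`, `j < 2 ^ (2 * n)`, and `0`
elsewhere. The number of cells is a power of `2`, and they exhaust the half-line as `n` grows. -/
noncomputable def step (n : ℕ) (c : ℕ → E) (t : ℝ) : E :=
  ∑ j ∈ Finset.range (2 ^ (2 * n)), (cell n j).indicator (fun _ => c j) t

lemma mem_cell_iff {n j : ℕ} {t : ℝ} : t ∈ cell n j ↔ ⌊2 ^ n * t⌋₊ = j + 1 := by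
  rw [Nat.floor_eq_iff' (Nat.succ_ne_zero j), cell, mem_Ico, div_le_iff₀ (by positivity),
    lt_div_iff₀ (by positivity), mul_comm t]
  push_cast
  rw [add_assoc, one_add_one_eq_two]

lemma measurableSet_cell (n j : ℕ) : MeasurableSet (cell n j) := measurableSet_Ico

lemma cell_subset_Ioi (n j : ℕ) : cell n j ⊆ Ioi 0 := by
  intro t ht
  exact lt_of_lt_of_le (by positivity) ht.1

lemma volume_cell (n j : ℕ) : volume (cell n j) = (2 ^ n)⁻¹ := by
  rw [cell, Real.volume_Ico, ← sub_div, show (j : ℝ) + 2 - (j + 1) = 1 by ring, one_div,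
    ENNReal.ofReal_inv_of_pos (by positivity), ENNReal.ofReal_pow (by norm_num),
    ENNReal.ofReal_ofNat]

lemma halfLine_restrict_cell (n j : ℕ) : halfLine.restrict (cell n j) =
    volume.restrict (cell n j) := by
  rw [halfLine, Measure.restrict_restrict (measurableSet_cell n j),
    inter_eq_left.2 (cell_subset_Ioi n j)]

lemma halfLine_cell (n j : ℕ) : halfLine (cell n j) = (2 ^ n)⁻¹ := by
  rw [halfLine, Measure.restrict_apply (measurableSet_cell n j),
    inter_eq_left.2 (cell_subset_Ioi n j), volume_cell]

lemma disjoint_cell (n : ℕ) : Pairwise (Function.onFun Disjoint (cell n)) := by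
  intro i j hij
  refine Set.disjoint_left.2 fun t hi hj => hij ?_
  rw [mem_cell_iff] at hi hj
  omega

lemma step_eq_ite (n : ℕ) (c : ℕ → E) (t : ℝ) : step n c t =
    ∑ j ∈ Finset.range (2 ^ (2 * n)), if ⌊2 ^ n * t⌋₊ = j + 1 then c j else 0 := by
  refine Finset.sum_congr rfl fun j _ => ?_
  by_cases h : t ∈ cell n j
  · rw [indicator_of_mem h, if_pos (mem_cell_iff.1 h)]
  · rw [indicator_of_notMem h, if_neg (fun h' => h (mem_cell_iff.2 h'))]

lemma step_of_mem {n j : ℕ} (hj : j < 2 ^ (2 * n)) (c : ℕ → E) {t : ℝ} (ht : t ∈ cell n j) :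
    step n c t = c j := by
  rw [step_eq_ite, Finset.sum_eq_single_of_mem j (Finset.mem_range.2 hj),
    if_pos (mem_cell_iff.1 ht)]
  intro i _ hij
  rw [if_neg]
  rw [mem_cell_iff.1 ht]
  omega

lemma step_of_notMem {n : ℕ} (c : ℕ → E) {t : ℝ} (ht : ∀ j < 2 ^ (2 * n), t ∉ cell n j) :
    step n c t = 0 :=
  Finset.sum_eq_zero fun j hj => indicator_of_notMem (ht j (Finset.mem_range.1 hj)) _

lemma step_congr {n : ℕ} {c c' : ℕ → E} (h : ∀ j < 2 ^ (2 * n), c j = c' j) :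
    step n c = step n c' := by
  ext t
  refine Finset.sum_congr rfl fun j hj => ?_
  rw [h j (Finset.mem_range.1 hj)]

lemma step_add (n : ℕ) (c d : ℕ → E) : step n (c + d) = step n c + step n d := by
  ext t
  simp only [step, Pi.add_apply, ← Finset.sum_add_distrib]
  exact Finset.sum_congr rfl fun j _ => congrFun (indicator_add _ (fun _ => c j) (fun _ => d j)) t

lemma step_sub (n : ℕ) (c d : ℕ → E) : step n (c - d) = step n c - step n d := by
  ext t
  simp only [step, Pi.sub_apply, ← Finset.sum_sub_distrib]
  exact Finset.sum_congr rfl fun j _ => congrFun (indicator_sub _ (fun _ => c j) (fun _ => d j)) t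

lemma step_smul {𝕜 : Type*} [NormedField 𝕜] [NormedSpace 𝕜 E] (n : ℕ) (a : 𝕜) (c : ℕ → E) :
    step n (a • c) = a • step n c := by
  ext t
  simp only [step, Pi.smul_apply, Finset.smul_sum]
  exact Finset.sum_congr rfl fun j _ => congrFun (indicator_const_smul _ a (fun _ => c j)) t

lemma memLp_step (n : ℕ) (c : ℕ → E) (p : ℝ≥0∞) : MemLp (step n c) p halfLine := by
  have h : MemLp (fun t => ∑ j ∈ Finset.range (2 ^ (2 * n)), (cell n j).indicator (fun _ => c j) t)
      p halfLine := by
    refine memLp_finsetSum _ fun j _ => memLp_indicator_const p (measurableSet_cell n j) _ ?_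
    refine Or.inr ?_
    rw [halfLine_cell]
    exact ENNReal.inv_ne_top.2 (by positivity)
  exact h

/-- The floor `⌊2ⁿ t⌋` is determined by the floor of a later generation. -/
lemma floor_two_pow_mul {m n : ℕ} (hnm : n ≤ m) (t : ℝ) :
    ⌊2 ^ n * t⌋₊ = ⌊2 ^ m * t⌋₊ / 2 ^ (m - n) := by
  have h := Nat.floor_div_natCast (2 ^ m * t) (2 ^ (m - n))
  rw [← h]
  congr 1
  have e : (2 : ℝ) ^ m = 2 ^ n * 2 ^ (m - n) := by rw [← pow_add, Nat.add_sub_cancel' hnm]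
  rw [e]
  push_cast
  field_simp

lemma lintegral_comp_step (n : ℕ) (c : ℕ → E) (φ : E → ℝ≥0∞) (h0 : φ 0 = 0) :
    ∫⁻ t, φ (step n c t) ∂halfLine =
      (2 ^ n)⁻¹ * ∑ j ∈ Finset.range (2 ^ (2 * n)), φ (c j) := by
  have e : ∀ t, φ (step n c t) =
      ∑ j ∈ Finset.range (2 ^ (2 * n)), (cell n j).indicator (fun _ => φ (c j)) t := by
    intro t
    by_cases h : ∃ j < 2 ^ (2 * n), t ∈ cell n j
    · obtain ⟨j, hj, ht⟩ := h
      rw [step_of_mem hj c ht, Finset.sum_eq_single_of_mem j (Finset.mem_range.2 hj),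
        indicator_of_mem ht]
      intro i _ hij
      exact indicator_of_notMem (fun hi => Set.disjoint_left.1 (disjoint_cell n hij) hi ht) _
    · push Not at h
      rw [step_of_notMem c h, h0]
      exact (Finset.sum_eq_zero fun j hj =>
        indicator_of_notMem (h j (Finset.mem_range.1 hj)) _).symm
  simp only [e]
  rw [lintegral_finsetSum _ fun j _ => measurable_const.indicator (measurableSet_cell n j),
    Finset.mul_sum]
  refine Finset.sum_congr rfl fun j _ => ?_
  rw [lintegral_indicator_const (measurableSet_cell n j), halfLine_cell, mul_comm]

lemma eLpNorm_step (n : ℕ) (c : ℕ → E) {p : ℝ} (hp : 0 < p) :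
    eLpNorm (step n c) (ENNReal.ofReal p) halfLine = ENNReal.ofReal
      (((2 ^ n)⁻¹ * ∑ j ∈ Finset.range (2 ^ (2 * n)), ‖c j‖ ^ p) ^ (1 / p)) := by
  rw [eLpNorm_eq_lintegral_rpow_enorm_toReal (by simpa using hp) ENNReal.ofReal_ne_top,
    ENNReal.toReal_ofReal hp.le,
    lintegral_comp_step n c (fun x => ‖x‖ₑ ^ p) (by simp [hp]),
    ← ENNReal.ofReal_rpow_of_nonneg (mul_nonneg (by positivity)
      (Finset.sum_nonneg fun j _ => by positivity)) (by positivity),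
    ENNReal.ofReal_mul (by positivity), ENNReal.ofReal_sum_of_nonneg fun j _ => by positivity]
  congr 2
  · rw [ENNReal.ofReal_inv_of_pos (by positivity), ENNReal.ofReal_pow (by norm_num),
      ENNReal.ofReal_ofNat]
  · refine Finset.sum_congr rfl fun j _ => ?_
    rw [← ENNReal.ofReal_rpow_of_nonneg (norm_nonneg _) hp.le, ofReal_norm]

lemma halfLine_level_step (n : ℕ) (c : ℕ → E) {a : ℝ} (ha : 0 ≤ a) :
    halfLine {t | a < ‖step n c t‖} = (2 ^ n)⁻¹ *
      (((Finset.range (2 ^ (2 * n))).filter fun j => a < ‖c j‖).card : ℝ≥0∞) := by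
  classical
  have h := lintegral_comp_step n c (fun x => if a < ‖x‖ then 1 else 0) (by simp [ha])
  have hm : NullMeasurableSet {t | a < ‖step n c t‖} halfLine :=
    nullMeasurableSet_lt aemeasurable_const (memLp_step n c 1).1.norm.aemeasurable
  have e : ∀ t, (if a < ‖step n c t‖ then (1 : ℝ≥0∞) else 0) =
      {t | a < ‖step n c t‖}.indicator (fun _ => 1) t := by
    intro t
    rw [indicator_apply]
    rfl
  simp only [e] at h
  rw [lintegral_indicator_const₀ hm, one_mul] at h
  rw [h, Finset.sum_boole]

variable [NormedSpace ℝ E]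

/-- The mean value of `u` over `cell n j`. -/
noncomputable def cellAvg (n : ℕ) (u : ℝ → E) (j : ℕ) : E := (2 : ℝ) ^ n • ∫ t in cell n j, u t

lemma cellAvg_congr {n j : ℕ} {u v : ℝ → E} (h : u =ᵐ[halfLine] v) :
    cellAvg n u j = cellAvg n v j := by
  rw [cellAvg, cellAvg]
  congr 1
  refine integral_congr_ae ?_
  rw [← halfLine_restrict_cell]
  exact ae_restrict_of_ae h

lemma cellAvg_of_const [CompleteSpace E] {n j : ℕ} {u : ℝ → E} {x : E}
    (h : ∀ t ∈ cell n j, u t = x) :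
    cellAvg n u j = x := by
  rw [cellAvg, setIntegral_congr_fun (measurableSet_cell n j) h, setIntegral_const,
    measureReal_def, volume_cell, smul_smul]
  simp

/-- A step function is also a step function of every later generation. -/
lemma step_cellAvg_step [CompleteSpace E] {m n : ℕ} (hnm : n ≤ m) (c : ℕ → E) :
    step m (cellAvg m (step n c)) = step n c := by
  have hconst : ∀ s t : ℝ, ⌊2 ^ m * s⌋₊ = ⌊2 ^ m * t⌋₊ → step n c s = step n c t := by
    intro s t h
    rw [step_eq_ite, step_eq_ite, floor_two_pow_mul hnm s, floor_two_pow_mul hnm t, h]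
  ext t
  by_cases h : ∃ j < 2 ^ (2 * m), t ∈ cell m j
  · obtain ⟨j, hj, ht⟩ := h
    rw [step_of_mem hj _ ht]
    refine cellAvg_of_const fun s hs => hconst s t ?_
    rw [mem_cell_iff.1 hs, mem_cell_iff.1 ht]
  · push Not at h
    rw [step_of_notMem _ h]
    refine (step_of_notMem _ fun j hj ht => ?_).symm
    have h1 := mem_cell_iff.1 ht
    rw [floor_two_pow_mul hnm] at h1
    set q := ⌊2 ^ m * t⌋₊ with hq
    have hd : 0 < 2 ^ (m - n) := by positivity
    have hq1 : 0 < q := by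
      by_contra h0
      have : q = 0 := by omega
      rw [this, Nat.zero_div] at h1
      omega
    have hq2 : 2 ^ (2 * m) < q := by
      by_contra h0
      refine h (q - 1) (by omega) (mem_cell_iff.2 ?_)
      omega
    have hq3 : q < (j + 2) * 2 ^ (m - n) := by
      rw [← Nat.div_lt_iff_lt_mul hd, h1]
      omega
    have e : 2 ^ (2 * m) = 2 ^ (2 * n) * 2 ^ (m - n) * 2 ^ (m - n) := by
      rw [mul_assoc, ← pow_add, ← pow_add]
      congr 1
      omega
    have hj' : j + 2 ≤ 2 ^ (2 * n) + 1 := by omega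
    have h2n : 0 < 2 ^ (2 * n) := by positivity
    rw [e] at hq2
    generalize 2 ^ (m - n) = d at *
    generalize 2 ^ (2 * n) = k at *
    nlinarith [Nat.mul_le_mul_right d hj', Nat.mul_le_mul h2n (Nat.mul_le_mul hd hd),
      mul_self_nonneg ((d : ℤ) - 1)]

/-- Hölder's inequality on a cell. -/
lemma enorm_cellAvg_le (n j : ℕ) {u : ℝ → E} (hu : AEStronglyMeasurable u halfLine) {p : ℝ≥0∞}
    (hp : 1 ≤ p) : ‖cellAvg n u j‖ₑ ≤
      (2 ^ n) ^ (1 / p.toReal) * eLpNorm u p (halfLine.restrict (cell n j)) := by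
  have h1 : ‖∫ t in cell n j, u t‖ₑ ≤ eLpNorm u p (halfLine.restrict (cell n j)) *
      ((2 ^ n)⁻¹) ^ (1 - 1 / p.toReal) := by
    have h := eLpNorm_le_eLpNorm_mul_rpow_measure_univ hp
      (hu.mono_measure (Measure.restrict_le_self (s := cell n j)))
    rw [Measure.restrict_apply_univ, halfLine_cell, ENNReal.toReal_one, div_one] at h
    refine le_trans ?_ h
    rw [eLpNorm_one_eq_lintegral_enorm, halfLine_restrict_cell]
    exact enorm_integral_le_lintegral_enorm _
  have h2 : ‖(2 : ℝ) ^ n‖ₑ = 2 ^ n := by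
    rw [Real.enorm_eq_ofReal (by positivity), ENNReal.ofReal_pow (by norm_num),
      ENNReal.ofReal_ofNat]
  rw [cellAvg, enorm_smul, h2]
  refine (mul_le_mul_right h1 _).trans (le_of_eq ?_)
  have h3 : (2 ^ n : ℝ≥0∞) ≠ 0 := by positivity
  have h4 : (2 ^ n : ℝ≥0∞) ≠ ∞ := ENNReal.pow_ne_top ENNReal.ofNat_ne_top
  rw [ENNReal.inv_rpow, ← ENNReal.rpow_neg, mul_comm (eLpNorm _ _ _), ← mul_assoc]
  congr 1
  nth_rewrite 1 [← ENNReal.rpow_one (2 ^ n)]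
  rw [← ENNReal.rpow_add _ _ h3 h4]
  congr 1
  ring

/-- Averaging over the cells is a contraction in `L^p`. -/
lemma eLpNorm_step_cellAvg_le (n : ℕ) {u : ℝ → E} (hu : AEStronglyMeasurable u halfLine)
    {p : ℝ≥0∞} (hp : 1 ≤ p) :
    eLpNorm (step n (cellAvg n u)) p halfLine ≤ eLpNorm u p halfLine := by
  by_cases hpt : p = ∞
  · subst hpt
    rw [eLpNorm_exponent_top, eLpNorm_exponent_top]
    refine eLpNormEssSup_le_of_ae_enorm_bound (Filter.Eventually.of_forall fun t => ?_)
    by_cases h : ∃ j < 2 ^ (2 * n), t ∈ cell n j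
    · obtain ⟨j, hj, ht⟩ := h
      rw [step_of_mem hj _ ht]
      have := enorm_cellAvg_le n j hu hp
      simp only [ENNReal.toReal_top, div_zero, ENNReal.rpow_zero, one_mul,
        eLpNorm_exponent_top] at this
      exact this.trans (eLpNormEssSup_mono_measure _ Measure.restrict_le_self.absolutelyContinuous)
    · push Not at h
      rw [step_of_notMem _ h, enorm_zero]
      exact zero_le
  have hp0 : p ≠ 0 := (zero_lt_one.trans_le hp).ne'
  have hpr : 0 < p.toReal := ENNReal.toReal_pos hp0 hpt
  rw [eLpNorm_eq_lintegral_rpow_enorm_toReal hp0 hpt,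
    eLpNorm_eq_lintegral_rpow_enorm_toReal hp0 hpt]
  refine ENNReal.rpow_le_rpow ?_ (by positivity)
  rw [lintegral_comp_step n _ (fun x => ‖x‖ₑ ^ p.toReal) (by simp [hpr]), Finset.mul_sum]
  have h3 : (2 ^ n : ℝ≥0∞) ≠ 0 := by positivity
  have h4 : (2 ^ n : ℝ≥0∞) ≠ ∞ := ENNReal.pow_ne_top ENNReal.ofNat_ne_top
  calc _ ≤ ∑ j ∈ Finset.range (2 ^ (2 * n)), ∫⁻ t in cell n j, ‖u t‖ₑ ^ p.toReal ∂halfLine := by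
        refine Finset.sum_le_sum fun j _ => ?_
        have := ENNReal.rpow_le_rpow (enorm_cellAvg_le n j hu hp) hpr.le
        rw [ENNReal.mul_rpow_of_nonneg _ _ hpr.le, ← ENNReal.rpow_mul,
          one_div_mul_cancel hpr.ne', ENNReal.rpow_one,
          eLpNorm_eq_lintegral_rpow_enorm_toReal hp0 hpt, ← ENNReal.rpow_mul,
          one_div_mul_cancel hpr.ne', ENNReal.rpow_one] at this
        refine (mul_le_mul_right this _).trans (le_of_eq ?_)
        rw [← mul_assoc, ENNReal.inv_mul_cancel h3 h4, one_mul]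
    _ = ∫⁻ t in ⋃ j ∈ Finset.range (2 ^ (2 * n)), cell n j, ‖u t‖ₑ ^ p.toReal ∂halfLine := by
        rw [lintegral_biUnion_finset (fun i _ j _ hij => disjoint_cell n hij)
          fun j _ => measurableSet_cell n j]
    _ ≤ _ := setLIntegral_le_lintegral _ _

end Averages

section Convergence

open Filter Topology

variable {E : Type*} [NormedAddCommGroup E]

/-! ### Convergence of the dyadic averages -/

instance : IsLocallyFiniteMeasure halfLine := by
  unfold halfLine
  infer_instance

/-- Every point of the half-line lies in a cell of each sufficiently late generation. -/
lemma eventually_mem_cell {t : ℝ} (ht : 0 < t) :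
    ∀ᶠ n : ℕ in atTop, ⌊2 ^ n * t⌋₊ - 1 < 2 ^ (2 * n) ∧ t ∈ cell n (⌊2 ^ n * t⌋₊ - 1) := by
  have hlim : Tendsto (fun n : ℕ => (2 : ℝ) ^ n) atTop atTop :=
    tendsto_pow_atTop_atTop_of_one_lt one_lt_two
  filter_upwards [hlim.eventually_ge_atTop t, hlim.eventually_ge_atTop t⁻¹] with n h1 h2
  have h3 : 1 ≤ 2 ^ n * t := by
    rw [inv_le_iff_one_le_mul₀ ht] at h2
    exact h2
  have h4 : 1 ≤ ⌊2 ^ n * t⌋₊ := Nat.one_le_floor_iff _ |>.2 h3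
  have h5 : ⌊2 ^ n * t⌋₊ ≤ 2 ^ (2 * n) := by
    refine Nat.floor_le_of_le ?_
    push_cast
    rw [two_mul, pow_add]
    gcongr
  exact ⟨by omega, mem_cell_iff.2 (by omega)⟩

lemma integrableOn_cell {u : ℝ → E} {p : ℝ≥0∞} (hp : 1 ≤ p) (hu : MemLp u p halfLine)
    (n j : ℕ) : IntegrableOn u (cell n j) := by
  have h : MemLp u p (volume.restrict (cell n j)) := by
    rw [← halfLine_restrict_cell]
    exact hu.restrict _
  have : IsFiniteMeasure (volume.restrict (cell n j)) := by
    refine ⟨?_⟩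
    rw [Measure.restrict_apply_univ, volume_cell]
    exact ENNReal.inv_lt_top.2 (by positivity)
  exact h.integrable hp

variable [NormedSpace ℝ E]

lemma cell_ae_eq_closedBall (n j : ℕ) : cell n j =ᵐ[volume]
    Metric.closedBall (((j : ℝ) + 1 + 1 / 2) / 2 ^ n) (1 / 2 / 2 ^ n) := by
  rw [Real.closedBall_eq_Icc, cell, ← sub_div, ← add_div]
  rw [show (j : ℝ) + 1 + 1 / 2 - 1 / 2 = j + 1 by ring,
    show (j : ℝ) + 1 + 1 / 2 + 1 / 2 = j + 2 by ring]
  exact Ico_ae_eq_Icc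

lemma cellAvg_eq_average (n j : ℕ) (u : ℝ → E) : cellAvg n u j =
    ⨍ t in Metric.closedBall (((j : ℝ) + 1 + 1 / 2) / 2 ^ n) (1 / 2 / 2 ^ n), u t := by
  rw [setAverage_eq, measureReal_def, ← measure_congr (cell_ae_eq_closedBall n j),
    ← setIntegral_congr_set (cell_ae_eq_closedBall n j), volume_cell, cellAvg]
  simp

/-- Lebesgue's differentiation theorem for the dyadic averages. -/
lemma ae_tendsto_step_cellAvg [CompleteSpace E] {u : ℝ → E} {p : ℝ≥0∞} (hp : 1 ≤ p)
    (hu : MemLp u p halfLine) :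
    ∀ᵐ t ∂halfLine, Tendsto (fun n => step n (cellAvg n u) t) atTop (𝓝 (u t)) := by
  set v : ℝ → E := (Ioi 0).indicator u with hv
  have hvm : MemLp v p volume := (memLp_indicator_iff_restrict measurableSet_Ioi).2 hu
  have h := IsUnifLocDoublingMeasure.ae_tendsto_average volume (hvm.locallyIntegrable hp) 1
  rw [halfLine]
  filter_upwards [ae_restrict_of_ae h, ae_restrict_mem measurableSet_Ioi] with t h ht
  have hδ : Tendsto (fun n : ℕ => 1 / 2 / (2 : ℝ) ^ n) atTop (𝓝[>] 0) := by
    refine tendsto_nhdsWithin_iff.2 ⟨?_, Eventually.of_forall fun n => by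
      simp only [mem_Ioi]; positivity⟩
    exact tendsto_const_nhds.div_atTop (tendsto_pow_atTop_atTop_of_one_lt one_lt_two)
  have hmem := eventually_mem_cell ht
  have h1 := h (fun n : ℕ => (((⌊2 ^ n * t⌋₊ - 1 : ℕ) : ℝ) + 1 + 1 / 2) / 2 ^ n) _ hδ (by
    filter_upwards [hmem] with n hn
    rw [one_mul, Real.closedBall_eq_Icc, ← sub_div, ← add_div]
    have := hn.2
    rw [cell] at this
    constructor
    · rw [add_sub_cancel_right]
      exact this.1
    · rw [add_assoc (_ + 1), add_halves, add_assoc, one_add_one_eq_two]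
      exact this.2.le)
  have e : v t = u t := indicator_of_mem ht u
  rw [e] at h1
  refine h1.congr' ?_
  filter_upwards [hmem] with n hn
  rw [step_of_mem hn.1 _ hn.2, ← cellAvg_eq_average, cellAvg, cellAvg]
  congr 1
  exact setIntegral_congr_fun (measurableSet_cell _ _)
    fun s hs => indicator_of_mem (cell_subset_Ioi _ _ hs) u

lemma norm_cellAvg_sub_le [CompleteSpace E] {n j : ℕ} {u : ℝ → E} {y : E} {ε : ℝ}
    (hu : IntegrableOn u (cell n j)) (h : ∀ t ∈ cell n j, ‖u t - y‖ ≤ ε) :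
    ‖cellAvg n u j - y‖ ≤ ε := by
  have hc : IntegrableOn (fun _ : ℝ => y) (cell n j) := by
    refine integrableOn_const ?_
    rw [volume_cell]
    exact ENNReal.inv_ne_top.2 (by positivity)
  have e : cellAvg n u j - y = (2 : ℝ) ^ n • ∫ t in cell n j, (u t - y) := by
    rw [integral_sub hu hc, smul_sub]
    congr 1
    exact (cellAvg_of_const (u := fun _ => y) fun _ _ => rfl).symm
  rw [e, norm_smul, Real.norm_of_nonneg (by positivity)]
  have := norm_setIntegral_le_of_norm_le_const
    (by rw [volume_cell]; exact ENNReal.inv_lt_top.2 (by positivity)) h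
  rw [measureReal_def, volume_cell] at this
  calc _ ≤ (2 : ℝ) ^ n * (ε * ((2 ^ n)⁻¹ : ℝ≥0∞).toReal) := by gcongr
    _ = ε := by
      rw [ENNReal.toReal_inv, ENNReal.toReal_pow, ENNReal.toReal_ofNat]
      field_simp

lemma cellAvg_add {u v : ℝ → E} {n j : ℕ} (hu : IntegrableOn u (cell n j))
    (hv : IntegrableOn v (cell n j)) : cellAvg n (u + v) j = cellAvg n u j + cellAvg n v j := by
  rw [cellAvg, cellAvg, cellAvg, ← smul_add]
  congr 1
  exact integral_add hu hv

lemma cellAvg_sub {u v : ℝ → E} {n j : ℕ} (hu : IntegrableOn u (cell n j))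
    (hv : IntegrableOn v (cell n j)) : cellAvg n (u - v) j = cellAvg n u j - cellAvg n v j := by
  rw [cellAvg, cellAvg, cellAvg, ← smul_sub]
  congr 1
  exact integral_sub hu hv

/-- For a compactly supported continuous function, the averages are dominated and converge almost
everywhere. -/
lemma tendsto_eLpNorm_step_cellAvg_sub_of_continuous [CompleteSpace E] {v : ℝ → E}
    (hv : Continuous v) (hvs : HasCompactSupport v) {p : ℝ≥0∞} (hp : 1 ≤ p) (hpt : p ≠ ∞) :
    Tendsto (fun n => eLpNorm (step n (cellAvg n v) - v) p halfLine) atTop (𝓝 0) := by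
  have hp0 : p ≠ 0 := (zero_lt_one.trans_le hp).ne'
  have hpr : 0 < p.toReal := ENNReal.toReal_pos hp0 hpt
  have hvm : MemLp v p halfLine := hv.memLp_of_hasCompactSupport hvs
  obtain ⟨C, hC⟩ := hvs.exists_bound_of_continuous hv
  have hC0 : 0 ≤ C := (norm_nonneg _).trans (hC 0)
  obtain ⟨R, hR⟩ := hvs.isCompact.isBounded.subset_closedBall 0
  rw [Real.closedBall_eq_Icc] at hR
  have hzero : ∀ t, R < t → v t = 0 := by
    intro t ht
    refine image_eq_zero_of_notMem_tsupport fun h => ?_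
    have := (hR h).2
    linarith
  have hstep : ∀ n t, ‖step n (cellAvg n v) t‖ ≤ C := by
    intro n t
    by_cases h : ∃ j < 2 ^ (2 * n), t ∈ cell n j
    · obtain ⟨j, hj, ht⟩ := h
      rw [step_of_mem hj _ ht, ← sub_zero (cellAvg n v j)]
      exact norm_cellAvg_sub_le (integrableOn_cell hp hvm n j) fun s _ => by simpa using hC s
    · push Not at h
      rw [step_of_notMem _ h, norm_zero]
      exact hC0
  have hstep0 : ∀ n t, R + 1 < t → step n (cellAvg n v) t = 0 := by
    intro n t htR
    by_cases h : ∃ j < 2 ^ (2 * n), t ∈ cell n j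
    · obtain ⟨j, hj, ht⟩ := h
      rw [step_of_mem hj _ ht]
      refine cellAvg_of_const fun s hs => hzero s ?_
      have h1 := ht.2
      have h2 := hs.1
      have h3 : ((j : ℝ) + 2) / 2 ^ n = ((j : ℝ) + 1) / 2 ^ n + 1 / 2 ^ n := by ring
      have h4 : 1 / (2 : ℝ) ^ n ≤ 1 := by
        rw [div_le_one (by positivity)]
        exact one_le_pow₀ one_le_two
      linarith
    · push Not at h
      rw [step_of_notMem _ h]
  have hint : Tendsto (fun n => ∫⁻ t, ‖(step n (cellAvg n v) - v) t‖ₑ ^ p.toReal ∂halfLine) atTop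
      (𝓝 (∫⁻ _, 0 ∂halfLine)) := by
    refine tendsto_lintegral_of_dominated_convergence'
      ((Iic (R + 1)).indicator fun _ => ENNReal.ofReal (2 * C) ^ p.toReal) ?_ ?_ ?_ ?_
    · intro n
      exact ((memLp_step n _ p).1.sub hvm.1).enorm.pow_const _
    · intro n
      refine Eventually.of_forall fun t => ?_
      change ‖step n (cellAvg n v) t - v t‖ₑ ^ p.toReal ≤ _
      by_cases ht : t ∈ Iic (R + 1)
      · rw [indicator_of_mem ht]
        gcongr
        rw [← ofReal_norm]
        refine ENNReal.ofReal_le_ofReal ((norm_sub_le _ _).trans ?_)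
        linarith [hstep n t, hC t]
      · rw [indicator_of_notMem ht]
        rw [mem_Iic, not_le] at ht
        rw [hstep0 n t ht, hzero t (by linarith)]
        simp [hpr]
    · rw [lintegral_indicator_const measurableSet_Iic]
      refine ENNReal.mul_ne_top (ENNReal.rpow_ne_top_of_nonneg hpr.le ENNReal.ofReal_ne_top) ?_
      rw [halfLine, Measure.restrict_apply measurableSet_Iic, inter_comm, Ioi_inter_Iic,
        Real.volume_Ioc]
      exact ENNReal.ofReal_ne_top
    · filter_upwards [ae_tendsto_step_cellAvg hp hvm] with t ht
      have h1 : Tendsto (fun n => (step n (cellAvg n v) - v) t) atTop (𝓝 0) := by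
        rw [← sub_self (v t)]
        exact ht.sub_const _
      have h2 := (ENNReal.continuous_rpow_const (y := p.toReal)).continuousAt.tendsto.comp h1.enorm
      rw [enorm_zero, ENNReal.zero_rpow_of_pos hpr] at h2
      exact h2
  rw [lintegral_zero] at hint
  have h2 := (ENNReal.continuous_rpow_const (y := 1 / p.toReal)).continuousAt.tendsto.comp hint
  rw [ENNReal.zero_rpow_of_pos (by positivity)] at h2
  refine h2.congr fun n => ?_
  rw [eLpNorm_eq_lintegral_rpow_enorm_toReal hp0 hpt]
  rfl

lemma step_cellAvg_sub {u v : ℝ → E} {p : ℝ≥0∞} (hp : 1 ≤ p) (hu : MemLp u p halfLine)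
    (hv : MemLp v p halfLine) (n : ℕ) : step n (cellAvg n (u - v)) =
      step n (cellAvg n u) - step n (cellAvg n v) := by
  rw [← step_sub]
  exact step_congr fun j _ =>
    cellAvg_sub (integrableOn_cell hp hu n j) (integrableOn_cell hp hv n j)

/-- The dyadic averages converge in `L^p`, `p < ∞`. -/
lemma tendsto_eLpNorm_step_cellAvg_sub [CompleteSpace E] {u : ℝ → E} {p : ℝ≥0∞} (hp : 1 ≤ p)
    (hpt : p ≠ ∞) (hu : MemLp u p halfLine) :
    Tendsto (fun n => eLpNorm (step n (cellAvg n u) - u) p halfLine) atTop (𝓝 0) := by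
  rw [ENNReal.tendsto_atTop_zero]
  intro ε hε
  by_cases hεt : ε = ∞
  · exact ⟨0, fun n _ => by rw [hεt]; exact le_top⟩
  have hε3 : ε / 3 ≠ 0 := (ENNReal.div_pos hε.ne' (by norm_num)).ne'
  obtain ⟨v, hvs, huv, hv, hvm⟩ := hu.exists_hasCompactSupport_eLpNorm_sub_le hpt hε3
  obtain ⟨N, hN⟩ := ENNReal.tendsto_atTop_zero.1
    (tendsto_eLpNorm_step_cellAvg_sub_of_continuous hv hvs hp hpt) (ε / 3) (pos_iff_ne_zero.2 hε3)
  refine ⟨N, fun n hn => ?_⟩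
  have e : step n (cellAvg n u) - u =
      step n (cellAvg n (u - v)) + (step n (cellAvg n v) - v) - (u - v) := by
    rw [step_cellAvg_sub hp hu hvm]
    abel
  have huvm := (hu.sub hvm).1
  rw [e]
  calc _ ≤ eLpNorm (step n (cellAvg n (u - v)) + (step n (cellAvg n v) - v)) p halfLine +
        eLpNorm (u - v) p halfLine :=
        eLpNorm_sub_le ((memLp_step n _ p).1.add ((memLp_step n _ p).1.sub hvm.1)) huvm hp
    _ ≤ eLpNorm (step n (cellAvg n (u - v))) p halfLine +
        eLpNorm (step n (cellAvg n v) - v) p halfLine + eLpNorm (u - v) p halfLine := by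
        gcongr
        exact eLpNorm_add_le (memLp_step n _ p).1 ((memLp_step n _ p).1.sub hvm.1) hp
    _ ≤ ε / 3 + ε / 3 + ε / 3 := by
        gcongr
        · exact (eLpNorm_step_cellAvg_le n huvm hp).trans huv
        · exact hN n hn
    _ = ε := ENNReal.add_thirds ε

/-- For a continuous function with compact support in the half-line, the averages converge
uniformly. -/
lemma tendsto_eLpNorm_top_step_cellAvg_sub [CompleteSpace E] {v : ℝ → E} (hv : Continuous v)
    (hvs : HasCompactSupport v) (hv0 : tsupport v ⊆ Ioi 0) :
    Tendsto (fun n => eLpNorm (step n (cellAvg n v) - v) ∞ halfLine) atTop (𝓝 0) := by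
  have hvm : MemLp v 1 halfLine := hv.memLp_of_hasCompactSupport hvs
  have hzero : ∀ t, t ∉ tsupport v → v t = 0 := fun t => image_eq_zero_of_notMem_tsupport
  -- The support is contained in some `[δ, R]`.
  obtain ⟨R, hR⟩ := hvs.isCompact.isBounded.subset_closedBall 0
  rw [Real.closedBall_eq_Icc] at hR
  obtain ⟨δ, hδ, hδv⟩ : ∃ δ > 0, ∀ t ∈ tsupport v, δ ≤ t := by
    rcases (tsupport v).eq_empty_or_nonempty with h | h
    · exact ⟨1, one_pos, by simp [h]⟩
    · obtain ⟨t, ht, htm⟩ := hvs.isCompact.exists_isLeast h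
      exact ⟨t, hv0 ht, fun s hs => htm hs⟩
  rw [ENNReal.tendsto_atTop_zero]
  intro ε hε
  by_cases hεt : ε = ∞
  · exact ⟨0, fun n _ => by rw [hεt]; exact le_top⟩
  have hεr : 0 < ε.toReal := ENNReal.toReal_pos hε.ne' hεt
  obtain ⟨η, hη, hηv⟩ := Metric.uniformContinuous_iff.1
    (hv.uniformContinuous_of_tendsto_cocompact hvs.is_zero_at_infty) ε.toReal hεr
  have hlim : Tendsto (fun n : ℕ => (2 : ℝ) ^ n) atTop atTop :=
    tendsto_pow_atTop_atTop_of_one_lt one_lt_two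
  obtain ⟨N, hN⟩ := eventually_atTop.1 ((hlim.eventually_gt_atTop η⁻¹).and
    ((hlim.eventually_gt_atTop δ⁻¹).and (hlim.eventually_ge_atTop R)))
  refine ⟨N, fun n hn => ?_⟩
  obtain ⟨h1, h2, h3⟩ := hN n hn
  have h2n : (0 : ℝ) < 2 ^ n := by positivity
  rw [inv_lt_iff_one_lt_mul₀ hη] at h1
  rw [inv_lt_iff_one_lt_mul₀ hδ] at h2
  rw [eLpNorm_exponent_top]
  refine eLpNormEssSup_le_of_ae_enorm_bound (Eventually.of_forall fun t => ?_)
  rw [← ofReal_norm, ← ENNReal.ofReal_toReal hεt]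
  refine ENNReal.ofReal_le_ofReal ?_
  rw [Pi.sub_apply]
  by_cases h : ∃ j < 2 ^ (2 * n), t ∈ cell n j
  · obtain ⟨j, hj, ht⟩ := h
    rw [step_of_mem hj _ ht]
    refine norm_cellAvg_sub_le (integrableOn_cell le_rfl hvm n j) fun s hs => ?_
    rw [← dist_eq_norm]
    refine (hηv ?_).le
    have e : ((j : ℝ) + 2) / 2 ^ n = ((j : ℝ) + 1) / 2 ^ n + 1 / 2 ^ n := by ring
    have h4 : 1 / 2 ^ n < η := by
      rw [div_lt_iff₀ h2n, mul_comm]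
      exact h1
    have := hs.1
    have := hs.2
    have := ht.1
    have := ht.2
    rw [Real.dist_eq, abs_lt]
    constructor <;> linarith
  · push Not at h
    rw [step_of_notMem _ h, hzero t, sub_zero, norm_zero]
    · exact hεr.le
    · intro hts
      have hδt := hδv t hts
      have htR := (hR hts).2
      rw [zero_add] at htR
      have h5 : 1 ≤ ⌊2 ^ n * t⌋₊ := by
        refine Nat.one_le_floor_iff _ |>.2 ?_
        nlinarith
      have h6 : ⌊2 ^ n * t⌋₊ ≤ 2 ^ (2 * n) := by
        refine Nat.floor_le_of_le ?_
        push_cast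
        rw [two_mul, pow_add]
        gcongr
        linarith
      exact h (⌊2 ^ n * t⌋₊ - 1) (by omega) (mem_cell_iff.2 (by omega))

end Convergence

section Discretization

variable {𝕜 E : Type*} [RCLike 𝕜] [NormedAddCommGroup E] [NormedSpace 𝕜 E]

/-! ### Discretization of an operator -/

/-- The class in `L^r` of a step function, linear in its values. -/
noncomputable def stepLp (𝕜 : Type*) {E : Type*} [RCLike 𝕜] [NormedAddCommGroup E]
    [NormedSpace 𝕜 E] (r : ℝ≥0∞) (n : ℕ) : (ℕ → E) →ₗ[𝕜] Lp E r halfLine where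
  toFun c := (memLp_step n c r).toLp _
  map_add' c d := by
    rw [← MemLp.toLp_add]
    simp only [step_add]
  map_smul' a c := by
    rw [RingHom.id_apply, ← MemLp.toLp_const_smul]
    simp only [step_smul]

lemma coeFn_stepLp (r : ℝ≥0∞) (n : ℕ) (c : ℕ → E) : stepLp 𝕜 r n c =ᵐ[halfLine] step n c :=
  (memLp_step n c r).coeFn_toLp

lemma stepLp_congr {r : ℝ≥0∞} {n m : ℕ} {c d : ℕ → E} (h : step n c = step m d) :
    stepLp 𝕜 r n c = stepLp 𝕜 r m d := by
  simp only [stepLp, LinearMap.coe_mk, AddHom.coe_mk, h]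

lemma step_single {n j : ℕ} (hj : j < 2 ^ (2 * n)) (x : E) :
    step n (Pi.single j x) = (cell n j).indicator fun _ => x := by
  ext t
  rw [step, Finset.sum_eq_single_of_mem j (Finset.mem_range.2 hj)]
  · simp
  · intro i _ hij
    simp [hij]

lemma step_single_of_le {n j : ℕ} (hj : 2 ^ (2 * n) ≤ j) (x : E) :
    step n (Pi.single j x) = 0 := by
  ext t
  refine Finset.sum_eq_zero fun i hi => ?_
  have : i ≠ j := by
    rw [Finset.mem_range] at hi
    omega
  simp [this]

lemma norm_stepLp_single_le (r : ℝ≥0∞) [Fact (1 ≤ r)] (n j : ℕ) (x : E) :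
    ‖stepLp 𝕜 r n (Pi.single j x)‖ ≤ ‖x‖ := by
  by_cases hj : j < 2 ^ (2 * n)
  · have h : eLpNorm (step n (Pi.single j x)) r halfLine ≤ ‖x‖ₑ := by
      rw [step_single hj]
      refine (eLpNorm_indicator_const_le x r).trans (mul_le_of_le_one_right zero_le ?_)
      refine ENNReal.rpow_le_one ?_ (by positivity)
      rw [halfLine_cell, ENNReal.inv_le_one]
      exact one_le_pow₀ one_le_two
    rw [Lp.norm_def, eLpNorm_congr_ae (coeFn_stepLp r n _), ← toReal_enorm x]
    exact ENNReal.toReal_mono enorm_ne_top h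
  · have : stepLp 𝕜 r n (Pi.single j x) = 0 := by
      rw [← map_zero (stepLp 𝕜 r n)]
      refine stepLp_congr ?_
      rw [step_single_of_le (not_lt.1 hj)]
      ext t
      simp [step]
    rw [this, norm_zero]
    exact norm_nonneg _

/-- The factor `2⁻ⁿ` between sums and integrals cancels in a strong type bound. -/
lemma eLpNorm_step_le_iff {n : ℕ} {X Y : Type*} [NormedAddCommGroup X] [NormedAddCommGroup Y]
    {c : ℕ → X} {d : ℕ → Y} {p K : ℝ} (hp : 0 < p) (hK : 0 ≤ K) :
    eLpNorm (step n d) (ENNReal.ofReal p) halfLine ≤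
      ENNReal.ofReal K * eLpNorm (step n c) (ENNReal.ofReal p) halfLine ↔
    ∑ j ∈ Finset.range (2 ^ (2 * n)), ‖d j‖ ^ p ≤
      K ^ p * ∑ j ∈ Finset.range (2 ^ (2 * n)), ‖c j‖ ^ p := by
  have hc : 0 ≤ ∑ j ∈ Finset.range (2 ^ (2 * n)), ‖c j‖ ^ p :=
    Finset.sum_nonneg fun j _ => by positivity
  have hd : 0 ≤ ∑ j ∈ Finset.range (2 ^ (2 * n)), ‖d j‖ ^ p :=
    Finset.sum_nonneg fun j _ => by positivity
  rw [eLpNorm_step n d hp, eLpNorm_step n c hp, ← ENNReal.ofReal_mul hK,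
    ENNReal.ofReal_le_ofReal_iff (by positivity)]
  have e : K * ((2 ^ n)⁻¹ * ∑ j ∈ Finset.range (2 ^ (2 * n)), ‖c j‖ ^ p) ^ (1 / p) =
      ((2 ^ n)⁻¹ * (K ^ p * ∑ j ∈ Finset.range (2 ^ (2 * n)), ‖c j‖ ^ p)) ^ (1 / p) := by
    rw [mul_left_comm, Real.mul_rpow (x := K ^ p) (by positivity) (by positivity),
      ← Real.rpow_mul hK, mul_one_div_cancel hp.ne', Real.rpow_one]
  rw [e, Real.rpow_le_rpow_iff (by positivity) (by positivity) (by positivity)]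
  exact mul_le_mul_iff_right₀ (by positivity)

variable [NormedSpace ℝ E] [IsScalarTower ℝ 𝕜 E]

lemma norm_cellAvg_le {r : ℝ≥0∞} [hr : Fact (1 ≤ r)] (n i : ℕ) (f : Lp E r halfLine) :
    ‖cellAvg n f i‖ ≤ (2 ^ n) ^ (1 / r.toReal) * ‖f‖ := by
  have h := (enorm_cellAvg_le n i (Lp.aestronglyMeasurable f) hr.out).trans
    (mul_le_mul_right (eLpNorm_mono_measure f Measure.restrict_le_self) _)
  have h4 : (2 ^ n : ℝ≥0∞) ≠ ∞ := ENNReal.pow_ne_top ENNReal.ofNat_ne_top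
  have := ENNReal.toReal_mono (ENNReal.mul_ne_top
    (ENNReal.rpow_ne_top_of_nonneg (by positivity) h4) (Lp.eLpNorm_ne_top f)) h
  rw [ENNReal.toReal_mul, ← ENNReal.toReal_rpow, ENNReal.toReal_pow, ENNReal.toReal_ofNat,
    toReal_enorm, ← Lp.norm_def] at this
  exact this

lemma cellAvg_smul (n i : ℕ) (a : 𝕜) (u : ℝ → E) : cellAvg n (a • u) i = a • cellAvg n u i := by
  rw [cellAvg, cellAvg, smul_comm a]
  congr 1
  exact integral_smul a u

/-- The mean value over a cell, as a bounded operator on `L^r`. -/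
noncomputable def cellAvgCLM (𝕜 : Type*) {E : Type*} [RCLike 𝕜] [NormedAddCommGroup E]
    [NormedSpace 𝕜 E] [NormedSpace ℝ E] [IsScalarTower ℝ 𝕜 E] (r : ℝ≥0∞) [Fact (1 ≤ r)]
    (n i : ℕ) : Lp E r halfLine →L[𝕜] E :=
  LinearMap.mkContinuous
    { toFun := fun f => cellAvg n f i
      map_add' := fun f g => by
        rw [cellAvg_congr (Lp.coeFn_add f g)]
        exact cellAvg_add (integrableOn_cell Fact.out (Lp.memLp f) n i)
          (integrableOn_cell Fact.out (Lp.memLp g) n i)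
      map_smul' := fun a f => by
        rw [cellAvg_congr (Lp.coeFn_smul a f)]
        exact cellAvg_smul n i a f }
    ((2 ^ n) ^ (1 / r.toReal)) (norm_cellAvg_le n i)

lemma cellAvgCLM_apply (r : ℝ≥0∞) [Fact (1 ≤ r)] (n i : ℕ) (f : Lp E r halfLine) :
    cellAvgCLM 𝕜 r n i f = cellAvg n f i := rfl

variable {X Y : Type*} [NormedAddCommGroup X] [NormedSpace 𝕜 X]
  [NormedAddCommGroup Y] [NormedSpace 𝕜 Y] [NormedSpace ℝ Y] [IsScalarTower ℝ 𝕜 Y]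
  {r : ℝ≥0∞} [Fact (1 ≤ r)]

/-- The class in `L^r` of the function equal to `x` on `cell n j` and to `0` elsewhere, as a bounded
operator in `x`. -/
noncomputable def cellLp (𝕜 : Type*) (X : Type*) [RCLike 𝕜] [NormedAddCommGroup X]
    [NormedSpace 𝕜 X] (r : ℝ≥0∞) [Fact (1 ≤ r)] (n j : ℕ) : X →L[𝕜] Lp X r halfLine :=
  LinearMap.mkContinuous
    (({ toFun := fun x => stepLp 𝕜 r n (Pi.single j x)
        map_add' := fun x y => by rw [Pi.single_add, map_add]
        map_smul' := fun a x => by rw [Pi.single_smul, map_smul, RingHom.id_apply] }) :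
      X →ₗ[𝕜] Lp X r halfLine)
    1 fun x => by
      rw [one_mul]
      exact norm_stepLp_single_le (𝕜 := 𝕜) r n j x

/-- The matrix of the compression of `T` to the step functions of generation `n`. -/
noncomputable def opMatrix (T : Lp X r halfLine →L[𝕜] Lp Y r halfLine) (n i j : ℕ) : X →L[𝕜] Y :=
  (cellAvgCLM 𝕜 r n i).comp (T.comp (cellLp 𝕜 X r n j))

lemma opMatrix_apply (T : Lp X r halfLine →L[𝕜] Lp Y r halfLine) (n i j : ℕ) (x : X) :
    opMatrix T n i j x = cellAvg n (T (stepLp 𝕜 r n (Pi.single j x))) i := rfl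

/-- The matrix maps the values of a step function `u` to the mean values of `T u`. -/
lemma matApply_opMatrix (T : Lp X r halfLine →L[𝕜] Lp Y r halfLine) (n i : ℕ) (c : ℕ → X) :
    matApply (2 ^ (2 * n)) (opMatrix T n) c i = cellAvg n (T (stepLp 𝕜 r n c)) i := by
  have e : stepLp 𝕜 r n c =
      ∑ j ∈ Finset.range (2 ^ (2 * n)), stepLp 𝕜 r n (Pi.single j (c j)) := by
    rw [← map_sum]
    refine stepLp_congr (step_congr fun j hj => ?_)
    rw [Finset.sum_apply, Finset.sum_eq_single_of_mem j (Finset.mem_range.2 hj)]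
    · simp
    · intro i _ hij
      simp [hij.symm]
  simp only [matApply, opMatrix_apply, ← cellAvgCLM_apply (𝕜 := 𝕜)]
  rw [e, map_sum, map_sum]

lemma strongBound_opMatrix (T : Lp X r halfLine →L[𝕜] Lp Y r halfLine) (n : ℕ) (hr : r ≠ ∞) :
    StrongBound (2 ^ (2 * n)) (opMatrix T n) r.toReal ‖T‖ := by
  have hr1 : 1 ≤ r := Fact.out
  have hr0 : 0 < r.toReal := ENNReal.toReal_pos (zero_lt_one.trans_le hr1).ne' hr
  intro c
  rw [← eLpNorm_step_le_iff hr0 (norm_nonneg _), ENNReal.ofReal_toReal hr]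
  have e : step n (matApply (2 ^ (2 * n)) (opMatrix T n) c) =
      step n (cellAvg n (T (stepLp 𝕜 r n c))) :=
    step_congr fun i _ => matApply_opMatrix T n i c
  rw [e]
  refine (eLpNorm_step_cellAvg_le n (Lp.aestronglyMeasurable _) hr1).trans ?_
  rw [← eLpNorm_congr_ae (coeFn_stepLp (𝕜 := 𝕜) r n c), ofReal_norm, ← Lp.enorm_def, ← Lp.enorm_def]
  exact T.le_opENorm _

lemma supBound_opMatrix (T : Lp X r halfLine →L[𝕜] Lp Y r halfLine) (n : ℕ) (hr : r = ∞) :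
    SupBound (2 ^ (2 * n)) (opMatrix T n) ‖T‖ := by
  intro c R hc i _
  have hR : 0 ≤ R := (norm_nonneg _).trans (hc 0 (by positivity))
  rw [matApply_opMatrix]
  refine (norm_cellAvg_le n i _).trans ?_
  have h0 : ((2 : ℝ) ^ n) ^ (1 / r.toReal) = 1 := by
    rw [hr, ENNReal.toReal_top, div_zero, Real.rpow_zero]
  rw [h0, one_mul]
  refine (T.le_opNorm _).trans ?_
  gcongr
  rw [Lp.norm_def, eLpNorm_congr_ae (coeFn_stepLp r n c)]
  refine ENNReal.toReal_le_of_le_ofReal hR ?_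
  subst hr
  rw [eLpNorm_exponent_top]
  refine eLpNormEssSup_le_of_ae_enorm_bound (Filter.Eventually.of_forall fun t => ?_)
  rw [← ofReal_norm]
  refine ENNReal.ofReal_le_ofReal ?_
  by_cases h : ∃ j < 2 ^ (2 * n), t ∈ cell n j
  · obtain ⟨j, hj, ht⟩ := h
    rw [step_of_mem hj _ ht]
    exact hc j hj
  · push Not at h
    rw [step_of_notMem _ h, norm_zero]
    exact hR

end Discretization

section Kernel

variable {𝕜 X Y : Type*} [RCLike 𝕜] [NormedAddCommGroup X] [NormedSpace 𝕜 X]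
  [NormedAddCommGroup Y] [NormedSpace 𝕜 Y]

/-! ### The kernel estimates for the matrix -/

lemma IsVolterraKernel.nonneg {σ M : ℝ} {K : ℝ → ℝ → X →L[𝕜] Y} (hK : IsVolterraKernel σ M K) :
    0 ≤ M := by
  have h := (norm_nonneg _).trans (hK.size 2 1 one_pos one_lt_two)
  norm_num at h
  exact h

/-- Smoothness in the second variable makes the kernel continuous, hence integrable on cells, in
that variable. -/
lemma IsVolterraKernel.continuousOn {σ M : ℝ} (hσ : 0 < σ) {K : ℝ → ℝ → X →L[𝕜] Y}
    (hK : IsVolterraKernel σ M K) (t : ℝ) : ContinuousOn (K t) (Ioo 0 t) := by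
  intro s₀ hs₀
  have hts : 0 < t - s₀ := sub_pos.2 hs₀.2
  refine ContinuousAt.continuousWithinAt ?_
  rw [ContinuousAt, tendsto_iff_norm_sub_tendsto_zero]
  have hlim : Filter.Tendsto (fun s => M * |s - s₀| ^ σ / (t - s₀) ^ (1 + σ)) (nhds s₀)
      (nhds 0) := by
    have h : ContinuousAt (fun s => M * |s - s₀| ^ σ / (t - s₀) ^ (1 + σ)) s₀ := by
      refine ContinuousAt.div_const (continuousAt_const.mul ?_) _
      exact ContinuousAt.rpow_const (by fun_prop) (Or.inr hσ.le)
    have e : M * |s₀ - s₀| ^ σ / (t - s₀) ^ (1 + σ) = 0 := by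
      rw [sub_self, abs_zero, Real.zero_rpow hσ.ne', mul_zero, zero_div]
    rw [← e]
    exact h
  refine squeeze_zero' (Filter.Eventually.of_forall fun s => norm_nonneg _) ?_ hlim
  filter_upwards [Ioo_mem_nhds hs₀.1 hs₀.2, Metric.ball_mem_nhds s₀ (half_pos hts)] with s hs hs'
  refine hK.smooth_right t s s₀ hs.1 hs₀.1 hs.2 hs₀.2 ?_
  rw [Metric.mem_ball, Real.dist_eq] at hs'
  linarith

/-- The Hölder exponent makes the tails of the matrix rows and columns summable. -/
lemma sum_Ico_rpow_le {σ : ℝ} (hσ : 0 < σ) {b : ℕ} (hb : 2 ≤ b) (n : ℕ) :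
    ∑ m ∈ Finset.Ico b n, 1 / (m : ℝ) ^ (1 + σ) ≤ ((b : ℝ) - 1) ^ (-σ) / σ := by
  have hterm : ∀ m : ℕ, 2 ≤ m →
      1 / (m : ℝ) ^ (1 + σ) ≤ ((m : ℝ) - 1) ^ (-σ) / σ - (m : ℝ) ^ (-σ) / σ := by
    intro m hm
    have hm2 : (2 : ℝ) ≤ m := by exact_mod_cast hm
    have hm0 : (0 : ℝ) < m := by linarith
    have hx : 0 < 1 - 1 / (m : ℝ) := by
      rw [sub_pos, div_lt_one hm0]
      linarith
    have h1 : 1 + σ / m ≤ (1 - 1 / (m : ℝ)) ^ (-σ) := by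
      rw [Real.rpow_def_of_pos hx]
      refine le_trans ?_ (Real.add_one_le_exp _)
      have := Real.log_le_sub_one_of_pos hx
      have e : σ / m = (1 - 1 / (m : ℝ) - 1) * (-σ) := by ring
      rw [e]
      nlinarith
    have e1 : ((m : ℝ) - 1) ^ (-σ) = (m : ℝ) ^ (-σ) * (1 - 1 / (m : ℝ)) ^ (-σ) := by
      rw [← Real.mul_rpow hm0.le hx.le]
      congr 1
      field_simp
    have e2 : 1 / (m : ℝ) ^ (1 + σ) = (m : ℝ) ^ (-σ) / m := by
      rw [Real.rpow_add hm0, Real.rpow_one, Real.rpow_neg hm0.le]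
      field_simp
    have hp : 0 < (m : ℝ) ^ (-σ) := Real.rpow_pos_of_pos hm0 _
    rw [e1, e2, ← sub_div, le_div_iff₀ hσ]
    calc (m : ℝ) ^ (-σ) / m * σ = (m : ℝ) ^ (-σ) * (1 + σ / m) - (m : ℝ) ^ (-σ) := by
          field_simp
          ring
      _ ≤ _ := by gcongr
  have hpos : ∀ m : ℕ, 2 ≤ m → 0 ≤ ((m : ℝ) - 1) ^ (-σ) / σ := by
    intro m hm
    have hm2 : (2 : ℝ) ≤ m := by exact_mod_cast hm
    have : (0 : ℝ) ≤ (m : ℝ) - 1 := by linarith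
    positivity
  rcases le_total n b with h | h
  · rw [Finset.Ico_eq_empty_of_le h, Finset.sum_empty]
    exact hpos b hb
  have key : ∑ m ∈ Finset.Ico b n, 1 / (m : ℝ) ^ (1 + σ) ≤
      ((b : ℝ) - 1) ^ (-σ) / σ - ((n : ℝ) - 1) ^ (-σ) / σ := by
    induction n, h using Nat.le_induction with
    | base => simp
    | succ n hn ih =>
      rw [Finset.sum_Ico_succ_top hn]
      have := hterm n (hb.trans hn)
      push_cast
      rw [add_sub_cancel_right]
      linarith
  linarith [hpos n (hb.trans h)]

/-- Summing the decay `(ℓ / m) ^ σ / m` over distinct `m ≥ 3ℓ`. -/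
lemma sum_decay_le {σ M : ℝ} (hσ : 0 < σ) (hM : 0 ≤ M) {ℓ : ℕ} (hℓ : 1 ≤ ℓ) (S : Finset ℕ)
    (g : ℕ → ℕ) (hg : Set.InjOn g S) (h3 : ∀ i ∈ S, 3 * ℓ ≤ g i) :
    ∑ i ∈ S, M * (ℓ : ℝ) ^ σ / (g i : ℝ) ^ (1 + σ) ≤ M / σ := by
  have hℓ1 : (1 : ℝ) ≤ ℓ := by exact_mod_cast hℓ
  obtain ⟨n, hn⟩ := (S.image g).exists_nat_subset_range
  have h1 : ∑ i ∈ S, 1 / (g i : ℝ) ^ (1 + σ) ≤ (ℓ : ℝ) ^ (-σ) / σ := by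
    rw [← Finset.sum_image (f := fun m : ℕ => 1 / (m : ℝ) ^ (1 + σ)) hg]
    calc _ ≤ ∑ m ∈ Finset.Ico (3 * ℓ) n, 1 / (m : ℝ) ^ (1 + σ) := by
          refine Finset.sum_le_sum_of_subset_of_nonneg ?_ fun m _ _ => by positivity
          intro m hm
          have h := Finset.mem_range.1 (hn hm)
          obtain ⟨i, hi, rfl⟩ := Finset.mem_image.1 hm
          exact Finset.mem_Ico.2 ⟨h3 i hi, h⟩
      _ ≤ (((3 * ℓ : ℕ) : ℝ) - 1) ^ (-σ) / σ := sum_Ico_rpow_le hσ (by omega) n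
      _ ≤ _ := by
          gcongr ?_ / _
          refine Real.rpow_le_rpow_of_nonpos (by linarith) ?_ (by linarith)
          push_cast
          linarith
  calc ∑ i ∈ S, M * (ℓ : ℝ) ^ σ / (g i : ℝ) ^ (1 + σ)
      = M * (ℓ : ℝ) ^ σ * ∑ i ∈ S, 1 / (g i : ℝ) ^ (1 + σ) := by
        rw [Finset.mul_sum]
        exact Finset.sum_congr rfl fun i _ => by ring
    _ ≤ M * (ℓ : ℝ) ^ σ * ((ℓ : ℝ) ^ (-σ) / σ) := by gcongr
    _ = M / σ := by
        rw [Real.rpow_neg (by positivity)]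
        field_simp

section Shift

variable {E : Type*} [NormedAddCommGroup E]

lemma preimage_add_cell (n a d : ℕ) :
    (fun s : ℝ => s + d / 2 ^ n) ⁻¹' cell n (a + d) = cell n a := by
  rw [cell, Set.preimage_add_const_Ico, ← sub_div, ← sub_div, cell]
  push_cast
  congr 2 <;> ring

variable [NormedSpace ℝ E]

lemma norm_setIntegral_cell_sub_le {n a d : ℕ} {g : ℝ → E} {ε : ℝ}
    (ha : IntegrableOn g (cell n a)) (hd : IntegrableOn g (cell n (a + d)))
    (h : ∀ s ∈ cell n a, ‖g (s + d / 2 ^ n) - g s‖ ≤ ε) :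
    ‖(∫ s in cell n (a + d), g s) - ∫ s in cell n a, g s‖ ≤ ε / 2 ^ n := by
  have hmp := measurePreserving_add_right (volume : Measure ℝ) ((d : ℝ) / 2 ^ n)
  have hme := measurableEmbedding_addRight ((d : ℝ) / 2 ^ n)
  have hd' : IntegrableOn (fun s => g (s + d / 2 ^ n)) (cell n a) := by
    have := (hmp.integrableOn_comp_preimage hme).2 hd
    rwa [preimage_add_cell] at this
  have e : ∫ s in cell n (a + d), g s = ∫ s in cell n a, g (s + d / 2 ^ n) := by
    rw [← hmp.setIntegral_preimage_emb hme, preimage_add_cell]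
  rw [e, ← integral_sub hd' ha]
  have := norm_setIntegral_le_of_norm_le_const
    (by rw [volume_cell]; exact ENNReal.inv_lt_top.2 (by positivity)) h
  refine this.trans (le_of_eq ?_)
  rw [measureReal_def, volume_cell, ENNReal.toReal_inv, ENNReal.toReal_pow, ENNReal.toReal_ofNat,
    div_eq_mul_inv]

lemma norm_cellAvg_le_of_ae {n j : ℕ} {u : ℝ → E} {ε : ℝ}
    (h : ∀ᵐ t ∂volume.restrict (cell n j), ‖u t‖ ≤ ε) : ‖cellAvg n u j‖ ≤ ε := by
  have := norm_setIntegral_le_of_norm_le_const_ae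
    (by rw [volume_cell]; exact ENNReal.inv_lt_top.2 (by positivity)) h
  rw [measureReal_def, volume_cell] at this
  rw [cellAvg, norm_smul, Real.norm_of_nonneg (by positivity)]
  calc _ ≤ (2 : ℝ) ^ n * (ε * ((2 ^ n)⁻¹ : ℝ≥0∞).toReal) := by gcongr
    _ = ε := by
      rw [ENNReal.toReal_inv, ENNReal.toReal_pow, ENNReal.toReal_ofNat]
      field_simp

end Shift

lemma cell_sub_le {n i j : ℕ} {s t : ℝ} (hs : s ∈ cell n j)
    (ht : t ∈ cell n i) : ((i : ℝ) - j - 1) / 2 ^ n ≤ t - s := by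
  have h1 := hs.2
  have h2 := ht.1
  have e : ((i : ℝ) - j - 1) / 2 ^ n = ((i : ℝ) + 1) / 2 ^ n - ((j : ℝ) + 2) / 2 ^ n := by ring
  rw [e]
  linarith

lemma IsVolterraKernel.integrableOn [NormedSpace ℝ Y] {σ M : ℝ} (hσ : 0 < σ)
    {K : ℝ → ℝ → X →L[𝕜] Y}
    (hK : IsVolterraKernel σ M K) {n i j : ℕ} (hij : j + 2 ≤ i) {t : ℝ} (ht : t ∈ cell n i)
    (x : X) : IntegrableOn (fun s => K t s x) (cell n j) := by
  have hij' : (j : ℝ) + 2 ≤ i := by exact_mod_cast hij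
  have hc : ContinuousOn (fun s => K t s x)
      (Icc (((j : ℝ) + 1) / 2 ^ n) (((j : ℝ) + 2) / 2 ^ n)) := by
    have h : ContinuousOn (fun s => K t s x) (Ioo 0 t) :=
      (hK.continuousOn hσ t).clm_apply continuousOn_const
    refine h.mono fun s hs => ⟨lt_of_lt_of_le (by positivity) hs.1, ?_⟩
    refine lt_of_le_of_lt hs.2 (lt_of_lt_of_le ?_ ht.1)
    exact div_lt_div_of_pos_right (by linarith) (by positivity)
  exact (hc.integrableOn_compact isCompact_Icc).mono_set Ico_subset_Icc_self

variable [NormedSpace ℝ Y] {r : ℝ≥0∞} [Fact (1 ≤ r)]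

/-- The representation by the kernel, for a function living on a cell and off the neighbouring
cells. -/
lemma ae_apply_cell {K : ℝ → ℝ → X →L[𝕜] Y} {T : Lp X r halfLine →L[𝕜] Lp Y r halfLine}
    (hT : ∀ (f : Lp X r halfLine) (F : Set ℝ), IsCompact F → F ⊆ Ioi 0 →
      (∀ᵐ s ∂halfLine, s ∉ F → f s = 0) →
      ∀ᵐ t ∂halfLine, t ∉ F → T f t = ∫ s in (0 : ℝ)..t, K t s (f s))
    {n i j : ℕ} (hj : j < 2 ^ (2 * n)) (hij : j + 2 ≤ i ∨ i + 2 ≤ j) (x : X) :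
    ∀ᵐ t ∂volume.restrict (cell n i), T (stepLp 𝕜 r n (Pi.single j x)) t =
      ∫ s in Ioc 0 t ∩ cell n j, K t s x := by
  set f := stepLp 𝕜 r n (Pi.single j x) with hf
  have hfs : f =ᵐ[halfLine] (cell n j).indicator fun _ => x := by
    rw [← step_single hj]
    exact coeFn_stepLp r n _
  have h := hT f (Icc (((j : ℝ) + 1) / 2 ^ n) (((j : ℝ) + 2) / 2 ^ n)) isCompact_Icc
    (fun s hs => lt_of_lt_of_le (by positivity) hs.1) (by
      filter_upwards [hfs] with s hs hsF
      rw [hs, indicator_of_notMem]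
      exact fun hs' => hsF ⟨hs'.1, hs'.2.le⟩)
  rw [← halfLine_restrict_cell]
  filter_upwards [ae_restrict_of_ae h, ae_restrict_mem (measurableSet_cell n i)] with t h ht
  have ht0 : 0 < t := cell_subset_Ioi n i ht
  rw [h, intervalIntegral.integral_of_le ht0.le, ← setIntegral_indicator (measurableSet_cell n j)]
  · have hsub : volume.restrict (Ioc 0 t) ≤ halfLine :=
      Measure.restrict_mono Ioc_subset_Ioi_self le_rfl
    refine integral_congr_ae ?_
    filter_upwards [ae_mono hsub hfs] with s hs
    rw [hs]
    by_cases hsc : s ∈ cell n j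
    · rw [indicator_of_mem hsc, indicator_of_mem hsc]
    · rw [indicator_of_notMem hsc, indicator_of_notMem hsc, map_zero]
  · rintro ⟨h1, h2⟩
    rcases hij with hij | hij
    · have hij' : (j : ℝ) + 2 < i + 1 := by exact_mod_cast Nat.lt_succ_of_le hij
      have := ht.1
      have : ((j : ℝ) + 2) / 2 ^ n < ((i : ℝ) + 1) / 2 ^ n := by gcongr
      linarith
    · have hij' : (i : ℝ) + 2 ≤ j + 1 := by exact_mod_cast Nat.le_succ_of_le hij
      have := ht.2
      have : ((i : ℝ) + 2) / 2 ^ n ≤ ((j : ℝ) + 1) / 2 ^ n := by gcongr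
      linarith

lemma ae_apply_cell_of_lt {K : ℝ → ℝ → X →L[𝕜] Y} {T : Lp X r halfLine →L[𝕜] Lp Y r halfLine}
    (hT : ∀ (f : Lp X r halfLine) (F : Set ℝ), IsCompact F → F ⊆ Ioi 0 →
      (∀ᵐ s ∂halfLine, s ∉ F → f s = 0) →
      ∀ᵐ t ∂halfLine, t ∉ F → T f t = ∫ s in (0 : ℝ)..t, K t s (f s))
    {n i j : ℕ} (hj : j < 2 ^ (2 * n)) (hij : j + 2 ≤ i) (x : X) :
    ∀ᵐ t ∂volume.restrict (cell n i), T (stepLp 𝕜 r n (Pi.single j x)) t =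
      ∫ s in cell n j, K t s x := by
  filter_upwards [ae_apply_cell hT hj (Or.inl hij) x, ae_restrict_mem (measurableSet_cell n i)]
    with t h ht
  rw [h, inter_eq_right.2]
  intro s hs
  refine ⟨cell_subset_Ioi n j hs, ?_⟩
  have h1 := cell_sub_le hs ht
  have h2 : (j : ℝ) + 2 ≤ i := by exact_mod_cast hij
  have h3 : 0 ≤ ((i : ℝ) - j - 1) / 2 ^ n := div_nonneg (by linarith) (by positivity)
  linarith

variable [IsScalarTower ℝ 𝕜 Y]

/-- The Volterra property: the matrix vanishes well above the diagonal. -/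
lemma opMatrix_eq_zero {K : ℝ → ℝ → X →L[𝕜] Y} {T : Lp X r halfLine →L[𝕜] Lp Y r halfLine}
    (hT : ∀ (f : Lp X r halfLine) (F : Set ℝ), IsCompact F → F ⊆ Ioi 0 →
      (∀ᵐ s ∂halfLine, s ∉ F → f s = 0) →
      ∀ᵐ t ∂halfLine, t ∉ F → T f t = ∫ s in (0 : ℝ)..t, K t s (f s))
    {n i j : ℕ} (hj : j < 2 ^ (2 * n)) (hij : i + 2 ≤ j) : opMatrix T n i j = 0 := by
  ext x
  rw [opMatrix_apply, zero_apply, ← norm_le_zero_iff]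
  refine norm_cellAvg_le_of_ae ?_
  filter_upwards [ae_apply_cell hT hj (Or.inr hij) x, ae_restrict_mem (measurableSet_cell n i)]
    with t h ht
  have e : Ioc 0 t ∩ cell n j = ∅ := by
    refine Set.disjoint_iff_inter_eq_empty.1 (Set.disjoint_left.2 fun s hs hs' => ?_)
    have h1 := cell_sub_le ht hs'
    have h2 : (i : ℝ) + 2 ≤ j := by exact_mod_cast hij
    have h3 : 0 < ((j : ℝ) - i - 1) / 2 ^ n := div_pos (by linarith) (by positivity)
    linarith [hs.2]
  rw [h, e, setIntegral_empty, norm_zero]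

/-- The scaling of the kernel bound from lengths to numbers of cells. -/
lemma kernel_bound_scale {σ M D δ : ℝ} (hσ : 0 < σ) (hM : 0 ≤ M) {n d m : ℕ} (hm : 1 ≤ m)
    (hD : D = d / 2 ^ n) (hδ : (m : ℝ) / 2 ^ n ≤ δ) :
    M * |D| ^ σ / δ ^ (1 + σ) ≤ 2 ^ n * (M * (d : ℝ) ^ σ / (m : ℝ) ^ (1 + σ)) := by
  have hm0 : (0 : ℝ) < m := by exact_mod_cast hm
  have h2n : (0 : ℝ) < 2 ^ n := by positivity
  subst hD
  rw [abs_of_nonneg (by positivity)]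
  calc M * ((d : ℝ) / 2 ^ n) ^ σ / δ ^ (1 + σ)
      ≤ M * ((d : ℝ) / 2 ^ n) ^ σ / ((m : ℝ) / 2 ^ n) ^ (1 + σ) := by gcongr
    _ = _ := by
      rw [Real.div_rpow (by positivity) h2n.le, Real.div_rpow hm0.le h2n.le, Real.rpow_add h2n,
        Real.rpow_one]
      field_simp

/-- Smoothness in the second variable, for the entries of row `a + 1 + m`: its cell has distance at
least `m` cells from `cell n a`, and the column moves by `d` cells. -/
lemma norm_opMatrix_sub_right_le {σ M : ℝ} (hσ : 0 < σ) {K : ℝ → ℝ → X →L[𝕜] Y}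
    (hK : IsVolterraKernel σ M K) {T : Lp X r halfLine →L[𝕜] Lp Y r halfLine}
    (hT : ∀ (f : Lp X r halfLine) (F : Set ℝ), IsCompact F → F ⊆ Ioi 0 →
      (∀ᵐ s ∂halfLine, s ∉ F → f s = 0) →
      ∀ᵐ t ∂halfLine, t ∉ F → T f t = ∫ s in (0 : ℝ)..t, K t s (f s))
    {n a d m : ℕ} (ha : a + d < 2 ^ (2 * n)) (hm : 1 ≤ m) (hdm : 2 * d ≤ m) :
    ‖opMatrix T n (a + 1 + m) (a + d) - opMatrix T n (a + 1 + m) a‖ ≤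
      M * (d : ℝ) ^ σ / (m : ℝ) ^ (1 + σ) := by
  have hM := hK.nonneg
  refine ContinuousLinearMap.opNorm_le_bound _ (by positivity) fun x => ?_
  set C := M * (d : ℝ) ^ σ / (m : ℝ) ^ (1 + σ) with hC
  rw [sub_apply, opMatrix_apply, opMatrix_apply, ← cellAvg_sub
    (integrableOn_cell Fact.out (Lp.memLp _) _ _) (integrableOn_cell Fact.out (Lp.memLp _) _ _)]
  refine norm_cellAvg_le_of_ae ?_
  filter_upwards [ae_apply_cell_of_lt (𝕜 := 𝕜) hT ha (show a + d + 2 ≤ a + 1 + m by omega) x,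
    ae_apply_cell_of_lt (𝕜 := 𝕜) hT (show a < 2 ^ (2 * n) by omega)
      (show a + 2 ≤ a + 1 + m by omega) x,
    ae_restrict_mem (measurableSet_cell n (a + 1 + m))] with t h1 h2 ht
  rw [Pi.sub_apply, h1, h2]
  have h := norm_setIntegral_cell_sub_le (g := fun s => K t s x) (ε := 2 ^ n * C * ‖x‖)
    (hK.integrableOn hσ (show a + 2 ≤ a + 1 + m by omega) ht x)
    (hK.integrableOn hσ (show a + d + 2 ≤ a + 1 + m by omega) ht x) ?_
  · refine h.trans (le_of_eq ?_)
    field_simp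
  intro s hs
  have hs' : s + d / 2 ^ n ∈ cell n (a + d) := by
    rw [← Set.mem_preimage (f := fun s : ℝ => s + d / 2 ^ n), preimage_add_cell]
    exact hs
  have hd1 := cell_sub_le hs ht
  have hd2 := cell_sub_le hs' ht
  push_cast at hd1 hd2
  rw [show (a : ℝ) + 1 + m - a - 1 = m by ring] at hd1
  have hpos : 0 < ((a : ℝ) + 1 + m - (a + d) - 1) / 2 ^ n := by
    have h3 : d + 1 ≤ m := by omega
    have h4 : (d : ℝ) + 1 ≤ m := by exact_mod_cast h3
    exact div_pos (by linarith) (by positivity)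
  have hd0 : (0 : ℝ) ≤ (d : ℝ) / 2 ^ n := by positivity
  rw [← sub_apply]
  refine (ContinuousLinearMap.le_opNorm _ x).trans ?_
  gcongr
  refine (hK.smooth_right t _ s (cell_subset_Ioi _ _ hs') (cell_subset_Ioi _ _ hs)
    (by linarith) (by linarith) ?_).trans
    (kernel_bound_scale hσ hM hm (by ring) hd1)
  rw [add_sub_cancel_left, abs_of_nonneg hd0]
  refine le_trans ?_ hd1
  rw [← mul_div_assoc]
  gcongr
  exact_mod_cast hdm

/-- Smoothness in the first variable, for the entries of column `j`: the cell of row `j + 1 + m` has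
distance at least `m` cells from `cell n j`, and the row moves by `d` cells. -/
lemma norm_opMatrix_sub_left_le {σ M : ℝ} (hσ : 0 < σ) {K : ℝ → ℝ → X →L[𝕜] Y}
    (hK : IsVolterraKernel σ M K) {T : Lp X r halfLine →L[𝕜] Lp Y r halfLine}
    (hT : ∀ (f : Lp X r halfLine) (F : Set ℝ), IsCompact F → F ⊆ Ioi 0 →
      (∀ᵐ s ∂halfLine, s ∉ F → f s = 0) →
      ∀ᵐ t ∂halfLine, t ∉ F → T f t = ∫ s in (0 : ℝ)..t, K t s (f s))
    {n j d m : ℕ} (hj : j < 2 ^ (2 * n)) (hm : 1 ≤ m) (hdm : 2 * d ≤ m) :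
    ‖opMatrix T n (j + 1 + m + d) j - opMatrix T n (j + 1 + m) j‖ ≤
      M * (d : ℝ) ^ σ / (m : ℝ) ^ (1 + σ) := by
  have hM := hK.nonneg
  refine ContinuousLinearMap.opNorm_le_bound _ (by positivity) fun x => ?_
  set C := M * (d : ℝ) ^ σ / (m : ℝ) ^ (1 + σ) with hC
  set a := j + 1 + m with ha
  have h1 := ae_apply_cell_of_lt (𝕜 := 𝕜) hT hj (show j + 2 ≤ a + d by omega) x
  have h2 := ae_apply_cell_of_lt (𝕜 := 𝕜) hT hj (show j + 2 ≤ a by omega) x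
  have hint : ∀ i, IntegrableOn (T (stepLp 𝕜 r n (Pi.single j x))) (cell n i) :=
    fun i => integrableOn_cell Fact.out (Lp.memLp _) _ _
  have h := norm_setIntegral_cell_sub_le (g := fun t => ∫ s in cell n j, K t s x)
    (ε := C * ‖x‖) ((hint a).congr h2) ((hint (a + d)).congr h1) ?_
  · rw [sub_apply, opMatrix_apply, opMatrix_apply, cellAvg, cellAvg, integral_congr_ae h1,
      integral_congr_ae h2, ← smul_sub, norm_smul, Real.norm_of_nonneg (by positivity)]
    calc _ ≤ (2 : ℝ) ^ n * (C * ‖x‖ / 2 ^ n) := by gcongr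
      _ = C * ‖x‖ := by field_simp
  intro t ht
  have ht' : t + d / 2 ^ n ∈ cell n (a + d) := by
    rw [← Set.mem_preimage (f := fun s : ℝ => s + d / 2 ^ n), preimage_add_cell]
    exact ht
  have hd0 : (0 : ℝ) ≤ (d : ℝ) / 2 ^ n := by positivity
  rw [← integral_sub (hK.integrableOn hσ (show j + 2 ≤ a + d by omega) ht' x)
    (hK.integrableOn hσ (show j + 2 ≤ a by omega) ht x)]
  have hle : ∀ s ∈ cell n j, ‖K (t + d / 2 ^ n) s x - K t s x‖ ≤ 2 ^ n * C * ‖x‖ := by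
    intro s hs
    have hd1 := cell_sub_le hs ht
    rw [ha] at hd1
    push_cast at hd1
    rw [show (j : ℝ) + 1 + m - j - 1 = m by ring] at hd1
    have hpos : (0 : ℝ) < (m : ℝ) / 2 ^ n := by
      have : (0 : ℝ) < m := by exact_mod_cast hm
      positivity
    rw [← sub_apply]
    refine (ContinuousLinearMap.le_opNorm _ x).trans ?_
    gcongr
    refine (hK.smooth_left _ t s (cell_subset_Ioi _ _ hs) (by linarith) (by linarith) ?_).trans
      (kernel_bound_scale hσ hM hm (by ring) hd1)
    rw [add_sub_cancel_left, abs_of_nonneg hd0]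
    refine le_trans ?_ hd1
    rw [← mul_div_assoc]
    gcongr
    exact_mod_cast hdm
  have := norm_setIntegral_le_of_norm_le_const
    (by rw [volume_cell]; exact ENNReal.inv_lt_top.2 (by positivity)) hle
  refine this.trans (le_of_eq ?_)
  rw [measureReal_def, volume_cell, ENNReal.toReal_inv, ENNReal.toReal_pow, ENNReal.toReal_ofNat]
  field_simp

/-- Only the part of the columns below the diagonal contributes, by the Volterra property, and there
the smoothness in the second variable is summable, uniformly in the generation `n`. -/
lemma hormander_opMatrix {σ M : ℝ} (hσ : 0 < σ) {K : ℝ → ℝ → X →L[𝕜] Y}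
    (hK : IsVolterraKernel σ M K) {T : Lp X r halfLine →L[𝕜] Lp Y r halfLine}
    (hT : ∀ (f : Lp X r halfLine) (F : Set ℝ), IsCompact F → F ⊆ Ioi 0 →
      (∀ᵐ s ∂halfLine, s ∉ F → f s = 0) →
      ∀ᵐ t ∂halfLine, t ∉ F → T f t = ∫ s in (0 : ℝ)..t, K t s (f s)) (n : ℕ) :
    Hormander (2 ^ (2 * n)) (opMatrix T n) (M / σ) := by
  intro a ℓ j haj hjℓ hN
  have hM := hK.nonneg
  set S := (Finset.range (2 ^ (2 * n))).filter
    (fun i => ¬ (a ≤ i + 3 * ℓ ∧ i < a + 4 * ℓ)) with hS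
  have hmem : ∀ i ∈ S, i + 3 * ℓ < a ∨ a + 4 * ℓ ≤ i := by
    intro i hi
    have := (Finset.mem_filter.1 hi).2
    omega
  calc ∑ i ∈ S, ‖opMatrix T n i j - opMatrix T n i a‖
      = ∑ i ∈ S.filter fun i => a + 4 * ℓ ≤ i, ‖opMatrix T n i j - opMatrix T n i a‖ := by
        refine (Finset.sum_filter_of_ne fun i hi hne => ?_).symm
        by_contra hlt
        have := hmem i hi
        refine hne ?_
        rw [opMatrix_eq_zero hT (by omega) (by omega), opMatrix_eq_zero hT (by omega) (by omega),
          sub_zero, norm_zero]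
    _ ≤ ∑ i ∈ S.filter fun i => a + 4 * ℓ ≤ i,
        M * (ℓ : ℝ) ^ σ / ((i - (a + 1) : ℕ) : ℝ) ^ (1 + σ) := by
        refine Finset.sum_le_sum fun i hi => ?_
        have hi' := (Finset.mem_filter.1 hi).2
        have h := norm_opMatrix_sub_right_le hσ hK hT (n := n) (a := a) (d := j - a)
          (m := i - (a + 1)) (by omega) (by omega) (by omega)
        rw [show a + 1 + (i - (a + 1)) = i by omega, show a + (j - a) = j by omega] at h
        refine h.trans ?_
        gcongr
        omega
    _ ≤ M / σ := by
        refine sum_decay_le hσ hM (by omega) _ _ ?_ fun i hi => ?_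
        · intro i hi i' hi' h
          have h1 := (Finset.mem_filter.1 (Finset.mem_coe.1 hi)).2
          have h2 := (Finset.mem_filter.1 (Finset.mem_coe.1 hi')).2
          simp only at h
          omega
        · have h1 := (Finset.mem_filter.1 hi).2
          omega

/-- The counterpart of `hormander_opMatrix` for rows, from the smoothness in the first variable. -/
lemma hormander_dualMatrix_opMatrix {σ M : ℝ} (hσ : 0 < σ) {K : ℝ → ℝ → X →L[𝕜] Y}
    (hK : IsVolterraKernel σ M K) {T : Lp X r halfLine →L[𝕜] Lp Y r halfLine}
    (hT : ∀ (f : Lp X r halfLine) (F : Set ℝ), IsCompact F → F ⊆ Ioi 0 →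
      (∀ᵐ s ∂halfLine, s ∉ F → f s = 0) →
      ∀ᵐ t ∂halfLine, t ∉ F → T f t = ∫ s in (0 : ℝ)..t, K t s (f s)) (n : ℕ) :
    Hormander (2 ^ (2 * n)) (dualMatrix (opMatrix T n)) (M / σ) := by
  intro a ℓ i hai hiℓ hN
  have hM := hK.nonneg
  set S := (Finset.range (2 ^ (2 * n))).filter
    (fun j => ¬ (a ≤ j + 3 * ℓ ∧ j < a + 4 * ℓ)) with hS
  have hmem : ∀ j ∈ S, (j + 3 * ℓ < a ∨ a + 4 * ℓ ≤ j) ∧ j < 2 ^ (2 * n) := by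
    intro j hj
    have h1 := (Finset.mem_filter.1 hj).2
    have h2 := Finset.mem_range.1 (Finset.mem_filter.1 hj).1
    exact ⟨by omega, h2⟩
  calc ∑ j ∈ S, ‖dualMatrix (opMatrix T n) j i - dualMatrix (opMatrix T n) j a‖
      ≤ ∑ j ∈ S, ‖opMatrix T n i j - opMatrix T n a j‖ :=
        Finset.sum_le_sum fun j _ => norm_dualMatrix_sub_le _ _ _ _ _
    _ = ∑ j ∈ S.filter fun j => j + 3 * ℓ < a, ‖opMatrix T n i j - opMatrix T n a j‖ := by
        refine (Finset.sum_filter_of_ne fun j hj hne => ?_).symm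
        by_contra hlt
        have := hmem j hj
        refine hne ?_
        rw [opMatrix_eq_zero hT (by omega) (by omega), opMatrix_eq_zero hT (by omega) (by omega),
          sub_zero, norm_zero]
    _ ≤ ∑ j ∈ S.filter fun j => j + 3 * ℓ < a,
        M * (ℓ : ℝ) ^ σ / ((a - (j + 1) : ℕ) : ℝ) ^ (1 + σ) := by
        refine Finset.sum_le_sum fun j hj => ?_
        have hj' := (Finset.mem_filter.1 hj).2
        have hjN := hmem j (Finset.mem_filter.1 hj).1
        have h := norm_opMatrix_sub_left_le hσ hK hT (n := n) (j := j) (d := i - a)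
          (m := a - (j + 1)) (by omega) (by omega) (by omega)
        rw [show j + 1 + (a - (j + 1)) = a by omega, show a + (i - a) = i by omega] at h
        refine h.trans ?_
        gcongr
        omega
    _ ≤ M / σ := by
        refine sum_decay_le hσ hM (by omega) _ _ ?_ fun j hj => ?_
        · intro j hj j' hj' h
          have h1 := (Finset.mem_filter.1 (Finset.mem_coe.1 hj)).2
          have h2 := (Finset.mem_filter.1 (Finset.mem_coe.1 hj')).2
          simp only at h
          omega
        · have h1 := (Finset.mem_filter.1 hj).2
          omega

end Kernel

section Measure

open Filter Topology

variable {α E : Type*} [MeasurableSpace α] {μ : Measure α} [NormedAddCommGroup E]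

/-! ### Convergence in measure -/

/-- Fatou's lemma for level sets. -/
lemma measure_lt_norm_le_of_tendsto {f : ℕ → α → E} {g : α → E} {a : ℝ} {D : ℝ≥0∞}
    (hfg : ∀ᵐ t ∂μ, Tendsto (fun k => f k t) atTop (𝓝 (g t)))
    (hD : ∀ᶠ k in atTop, μ {t | a < ‖f k t‖} ≤ D) : μ {t | a < ‖g t‖} ≤ D := by
  obtain ⟨k₀, hk₀⟩ := eventually_atTop.1 hD
  have hmono : Monotone fun N : ℕ => ⋂ k ≥ N, {t | a < ‖f k t‖} := by
    intro N N' h t ht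
    simp only [mem_iInter] at ht ⊢
    exact fun k hk => ht k (h.trans hk)
  calc μ {t | a < ‖g t‖} ≤ μ (⋃ N : ℕ, ⋂ k ≥ N, {t | a < ‖f k t‖}) := by
        refine measure_mono_ae ?_
        filter_upwards [hfg] with t ht hat
        obtain ⟨N, hN⟩ := eventually_atTop.1 (ht.norm.eventually_const_lt hat)
        exact mem_iUnion.2 ⟨N, mem_iInter₂.2 hN⟩
    _ = ⨆ N : ℕ, μ (⋂ k ≥ N, {t | a < ‖f k t‖}) := hmono.measure_iUnion
    _ ≤ D := by
        refine iSup_le fun N => ?_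
        refine (measure_mono ?_).trans (hk₀ (max N k₀) (le_max_right _ _))
        exact iInter₂_subset _ (le_max_left _ _)

/-- A sequence that is Cauchy in measure converges in measure. -/
lemma exists_tendstoInMeasure_of_cauchy [CompleteSpace E] {f : ℕ → α → E}
    (hf : ∀ n, AEStronglyMeasurable (f n) μ)
    (hc : ∀ ε : ℝ, 0 < ε →
      Tendsto (fun q : ℕ × ℕ => μ {t | ε < ‖f q.1 t - f q.2 t‖}) atTop (𝓝 0)) :
    ∃ g : α → E, StronglyMeasurable g ∧ TendstoInMeasure μ f atTop g := by
  have hN : ∀ ε : ℝ, 0 < ε → ∀ η : ℝ≥0∞, 0 < η → ∃ N : ℕ, ∀ n ≥ N, ∀ m ≥ N,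
      μ {t | ε < ‖f n t - f m t‖} ≤ η := by
    intro ε hε η hη
    obtain ⟨⟨a, b⟩, hab⟩ := eventually_atTop.1 ((hc ε hε).eventually_le_const hη)
    exact ⟨max a b, fun n hn m hm =>
      hab (n, m) ⟨(le_max_left _ _).trans hn, (le_max_right _ _).trans hm⟩⟩
  -- A subsequence with summable exceptional sets converges almost everywhere.
  choose N hN' using fun k : ℕ => hN ((1 / 2) ^ k) (by positivity) ((1 / 2) ^ k)
    (ENNReal.pow_pos (by norm_num) k)
  set φ : ℕ → ℕ := fun k => k + ∑ i ∈ Finset.range (k + 1), N i with hφ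
  have hφN : ∀ k, N k ≤ φ k := fun k =>
    (Finset.single_le_sum (fun i _ => Nat.zero_le (N i))
      (Finset.self_mem_range_succ k)).trans (Nat.le_add_left _ _)
  have hφs : ∀ k, φ k ≤ φ (k + 1) := by
    intro k
    have := Finset.sum_range_succ N (k + 1)
    simp only [hφ]
    omega
  have hφt : Tendsto φ atTop atTop :=
    tendsto_atTop_mono (fun k => Nat.le_add_right k _) tendsto_id
  have hsum : ∑' k, μ {t | (1 / 2) ^ k < ‖f (φ (k + 1)) t - f (φ k) t‖} ≠ ∞ := by
    refine ne_top_of_le_ne_top ?_ (ENNReal.tsum_le_tsum fun k =>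
      hN' k (φ (k + 1)) ((hφN k).trans (hφs k)) (φ k) (hφN k))
    rw [ENNReal.tsum_geometric]
    simp
  have hlim : ∀ᵐ t ∂μ, ∃ l, Tendsto (fun k => f (φ k) t) atTop (𝓝 l) := by
    filter_upwards [ae_eventually_notMem hsum] with t ht
    refine cauchySeq_tendsto_of_complete (cauchySeq_of_summable_dist ?_)
    refine Summable.of_norm_bounded_eventually_nat (g := fun k => (1 / 2 : ℝ) ^ k)
      (summable_geometric_of_lt_one (by norm_num) (by norm_num)) ?_
    filter_upwards [ht] with k hk
    have hk := not_lt.1 hk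
    rw [Real.norm_of_nonneg dist_nonneg, dist_comm, dist_eq_norm]
    exact hk
  obtain ⟨g, hg, hfg⟩ := exists_stronglyMeasurable_limit_of_tendsto_ae (fun k => hf (φ k)) hlim
  refine ⟨g, hg, tendstoInMeasure_iff_norm.2 fun ε hε => ?_⟩
  rw [ENNReal.tendsto_atTop_zero]
  intro η hη
  obtain ⟨n₀, hn₀⟩ := hN (ε / 2) (by positivity) η hη
  refine ⟨n₀, fun n hn => ?_⟩
  calc μ {t | ε ≤ ‖f n t - g t‖} ≤ μ {t | ε / 2 < ‖f n t - g t‖} :=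
        measure_mono fun t ht => (half_lt_self hε).trans_le ht
    _ ≤ η := by
        refine measure_lt_norm_le_of_tendsto (f := fun k t => f n t - f (φ k) t) ?_ ?_
        · filter_upwards [hfg] with t ht
          exact ht.const_sub _
        · filter_upwards [hφt.eventually_ge_atTop n₀] with k hk
          exact hn₀ n hn _ hk

/-- Limits in measure are additive, by uniqueness along an almost everywhere convergent
subsequence. -/
lemma TendstoInMeasure.ae_eq_add {f₁ f₂ f₃ : ℕ → α → E} {g₁ g₂ g₃ : α → E}
    (h₁ : TendstoInMeasure μ f₁ atTop g₁) (h₂ : TendstoInMeasure μ f₂ atTop g₂)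
    (h₃ : TendstoInMeasure μ f₃ atTop g₃) (h : ∀ n, f₃ n =ᵐ[μ] f₁ n + f₂ n) :
    g₃ =ᵐ[μ] g₁ + g₂ := by
  obtain ⟨a, ha, ha'⟩ := h₁.exists_seq_tendsto_ae'
  obtain ⟨b, hb, hb'⟩ := (h₂.comp ha).exists_seq_tendsto_ae'
  obtain ⟨c, hc, hc'⟩ := ((h₃.comp ha).comp hb).exists_seq_tendsto_ae'
  filter_upwards [ha', hb', hc', ae_all_iff.2 h] with t h1 h2 h3 h4
  have h5 := ((h1.comp hb).comp hc).add (h2.comp hc)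
  refine tendsto_nhds_unique h3 (h5.congr fun n => ?_)
  exact (h4 _).symm

lemma TendstoInMeasure.ae_eq_smul {𝕜 : Type*} [NormedField 𝕜] [NormedSpace 𝕜 E] (a : 𝕜)
    {f₁ f₂ : ℕ → α → E} {g₁ g₂ : α → E}
    (h₁ : TendstoInMeasure μ f₁ atTop g₁) (h₂ : TendstoInMeasure μ f₂ atTop g₂)
    (h : ∀ n, f₂ n =ᵐ[μ] a • f₁ n) : g₂ =ᵐ[μ] a • g₁ := by
  obtain ⟨u, hu, hu'⟩ := h₁.exists_seq_tendsto_ae'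
  obtain ⟨v, hv, hv'⟩ := (h₂.comp hu).exists_seq_tendsto_ae'
  filter_upwards [hu', hv', ae_all_iff.2 h] with t h1 h2 h3
  refine tendsto_nhds_unique h2 (((h1.comp hv).const_smul a).congr fun n => ?_)
  exact (h3 _).symm

end Measure

section StepBounds

open Filter Topology

variable {𝕜 X Y : Type*} [RCLike 𝕜] [NormedAddCommGroup X] [NormedSpace 𝕜 X] [NormedSpace ℝ X]
  [CompleteSpace X]
  [NormedAddCommGroup Y] [NormedSpace 𝕜 Y] [NormedSpace ℝ Y] [IsScalarTower ℝ 𝕜 Y] [CompleteSpace Y]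
  {p r : ℝ≥0∞} [Fact (1 ≤ p)] [Fact (1 ≤ r)]

/-! ### Bounds on step functions -/

/-- A step function of generation `n` is one of all later generations, so that the matrices of these
generations compute averages of its image. -/
lemma ae_tendsto_step_matApply
    (T : Lp X r halfLine →L[𝕜] Lp Y r halfLine) (n : ℕ) (c : ℕ → X) :
    ∀ᵐ t ∂halfLine, Tendsto (fun k => step (k + n) (matApply (2 ^ (2 * (k + n)))
      (opMatrix T (k + n)) (cellAvg (k + n) (step n c))) t) atTop
      (𝓝 (T (stepLp 𝕜 r n c) t)) := by
  filter_upwards [ae_tendsto_step_cellAvg Fact.out (Lp.memLp (T (stepLp 𝕜 r n c)))] with t ht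
  refine (ht.comp (tendsto_add_atTop_nat n)).congr fun k => ?_
  have e : stepLp 𝕜 r (k + n) (cellAvg (k + n) (step n c)) = stepLp 𝕜 r n c :=
    stepLp_congr (step_cellAvg_step (Nat.le_add_left n k) c)
  refine congrFun (step_congr fun i _ => ?_) t
  rw [matApply_opMatrix, e]

/-- By Fatou's lemma, a strong type bound common to all the matrices holds for `T` on step
functions. -/
lemma eLpNorm_apply_stepLp_le
    {T : Lp X r halfLine →L[𝕜] Lp Y r halfLine} {q C : ℝ} (hq : 0 < q) (hC : 0 ≤ C)
    (h : ∀ n, StrongBound (2 ^ (2 * n)) (opMatrix T n) q C) (n : ℕ) (c : ℕ → X) :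
    eLpNorm (T (stepLp 𝕜 r n c)) (ENNReal.ofReal q) halfLine ≤
      ENNReal.ofReal C * eLpNorm (step n c) (ENNReal.ofReal q) halfLine := by
  refine Lp.eLpNorm_le_of_ae_tendsto (Eventually.of_forall fun k => ?_)
    (fun k => (memLp_step _ _ q.toNNReal).1) (ae_tendsto_step_matApply T n c)
  have := (eLpNorm_step_le_iff hq hC).2 (h (k + n) (cellAvg (k + n) (step n c)))
  rwa [step_cellAvg_step (Nat.le_add_left n k)] at this

lemma eLpNorm_one_step {E : Type*} [NormedAddCommGroup E] (n : ℕ) (c : ℕ → E) :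
    eLpNorm (step n c) 1 halfLine = ENNReal.ofReal
      ((2 ^ n)⁻¹ * ∑ j ∈ Finset.range (2 ^ (2 * n)), ‖c j‖) := by
  have := eLpNorm_step n c one_pos
  simpa using this

/-- A weak type `(1, 1)` bound common to all the matrices holds for `T` on step functions. -/
lemma measure_apply_stepLp_le
    {T : Lp X r halfLine →L[𝕜] Lp Y r halfLine} {C : ℝ} (hC : 0 ≤ C)
    (h : ∀ n, WeakOne (2 ^ (2 * n)) (opMatrix T n) C) (n : ℕ) (c : ℕ → X) {a : ℝ} (ha : 0 < a) :
    halfLine {t | a < ‖T (stepLp 𝕜 r n c) t‖} ≤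
      (ENNReal.ofReal a)⁻¹ * (ENNReal.ofReal C * eLpNorm (step n c) 1 halfLine) := by
  refine measure_lt_norm_le_of_tendsto (ae_tendsto_step_matApply T n c)
    (Eventually.of_forall fun k => ?_)
  rw [← ENNReal.mul_le_iff_le_inv (by simpa using ha) ENNReal.ofReal_ne_top,
    halfLine_level_step _ _ ha.le]
  have hw := h (k + n) (cellAvg (k + n) (step n c)) a ha
  have e := eLpNorm_one_step (k + n) (cellAvg (k + n) (step n c))
  rw [step_cellAvg_step (Nat.le_add_left n k)] at e
  rw [e, ← ENNReal.ofReal_mul hC, ← ENNReal.ofReal_natCast, ← ENNReal.ofReal_ofNat 2,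
    ← ENNReal.ofReal_pow (by norm_num), ← ENNReal.ofReal_inv_of_pos (by positivity),
    ← ENNReal.ofReal_mul (by positivity), ← ENNReal.ofReal_mul ha.le]
  refine ENNReal.ofReal_le_ofReal ?_
  rw [mul_left_comm, mul_left_comm C]
  gcongr

end StepBounds

section Extension

open Filter Topology

variable {𝕜 X Y : Type*} [RCLike 𝕜] [NormedAddCommGroup X] [NormedSpace 𝕜 X]
  [NormedAddCommGroup Y] [NormedSpace 𝕜 Y] {p r : ℝ≥0∞} [Fact (1 ≤ r)]

/-! ### Extension by density -/

/-- The operator `T` is of weak type `(p, p)` on step functions. -/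
def WeakOnSteps (p : ℝ≥0∞) (T : Lp X r halfLine →L[𝕜] Lp Y r halfLine) : Prop :=
  ∀ ε : ℝ, 0 < ε → ∃ D : ℝ≥0∞, D ≠ ∞ ∧ ∀ (n : ℕ) (c : ℕ → X),
    halfLine {t | ε < ‖T (stepLp 𝕜 r n c) t‖} ≤ D * eLpNorm (step n c) p halfLine ^ p.toReal

variable [NormedSpace ℝ X] [IsScalarTower ℝ 𝕜 X] [Fact (1 ≤ p)]

/-- Dyadic averaging, which turns an element of `L^p` into a step function and thus into an element
of `L^r`. -/
noncomputable def dyadicProj (𝕜 X : Type*) [RCLike 𝕜] [NormedAddCommGroup X] [NormedSpace 𝕜 X]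
    [NormedSpace ℝ X] [IsScalarTower ℝ 𝕜 X] (p r : ℝ≥0∞) [Fact (1 ≤ p)] [Fact (1 ≤ r)] (n : ℕ) :
    Lp X p halfLine →ₗ[𝕜] Lp X r halfLine :=
  (stepLp 𝕜 r n).comp (LinearMap.pi fun j => (cellAvgCLM 𝕜 p n j).toLinearMap)

lemma dyadicProj_apply (n : ℕ) (f : Lp X p halfLine) :
    dyadicProj 𝕜 X p r n f = stepLp 𝕜 r n (cellAvg n f) := rfl

variable [CompleteSpace X] [CompleteSpace Y]

omit [IsScalarTower ℝ 𝕜 X] [Fact (1 ≤ r)] in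
lemma exists_stepLp_sub (n m : ℕ) (c d : ℕ → X) : ∃ e : ℕ → X,
    stepLp 𝕜 r n c - stepLp 𝕜 r m d = stepLp 𝕜 r (max n m) e ∧
      step (max n m) e = step n c - step m d := by
  have hn := step_cellAvg_step (le_max_left n m) c
  have hm := step_cellAvg_step (le_max_right n m) d
  refine ⟨cellAvg (max n m) (step n c) - cellAvg (max n m) (step m d), ?_, ?_⟩
  · rw [map_sub, stepLp_congr hn, stepLp_congr hm]
  · rw [step_sub, hn, hm]

/-- The images of the dyadic averages converge in measure. -/
lemma exists_tendstoInMeasure_dyadicProj (hp : p ≠ ∞)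
    {T : Lp X r halfLine →L[𝕜] Lp Y r halfLine} (hT : WeakOnSteps p T) (f : Lp X p halfLine) :
    ∃ g : ℝ → Y, StronglyMeasurable g ∧
      TendstoInMeasure halfLine (fun n => T (dyadicProj 𝕜 X p r n f)) atTop g := by
  have hp1 : 1 ≤ p := Fact.out
  have hpr : 0 < p.toReal := ENNReal.toReal_pos (zero_lt_one.trans_le hp1).ne' hp
  refine exists_tendstoInMeasure_of_cauchy (fun n => Lp.aestronglyMeasurable _) fun ε hε => ?_
  obtain ⟨D, hD, hDT⟩ := hT ε hε
  set e : ℕ → ℝ≥0∞ := fun n => eLpNorm (step n (cellAvg n f) - (f : ℝ → X)) p halfLine with he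
  have hlim : Tendsto e atTop (𝓝 0) := tendsto_eLpNorm_step_cellAvg_sub hp1 hp (Lp.memLp f)
  have hlim2 : Tendsto (fun q : ℕ × ℕ => D * (e q.1 + e q.2) ^ p.toReal) atTop (𝓝 0) := by
    have h1 : Tendsto (fun q : ℕ × ℕ => e q.1 + e q.2) atTop (𝓝 (0 + 0)) := by
      rw [← prod_atTop_atTop_eq]
      exact (hlim.comp tendsto_fst).add (hlim.comp tendsto_snd)
    have h2 := (ENNReal.continuous_rpow_const (y := p.toReal)).continuousAt.tendsto.comp h1
    have h3 := ENNReal.Tendsto.const_mul h2 (Or.inr hD)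
    rw [add_zero, ENNReal.zero_rpow_of_pos hpr, mul_zero] at h3
    exact h3
  refine tendsto_of_tendsto_of_tendsto_of_le_of_le tendsto_const_nhds hlim2
    (fun _ => zero_le) fun q => ?_
  obtain ⟨c, hc, hc'⟩ := exists_stepLp_sub (𝕜 := 𝕜) (r := r) q.1 q.2 (cellAvg q.1 f) (cellAvg q.2 f)
  calc halfLine {t | ε < ‖T (dyadicProj 𝕜 X p r q.1 f) t - T (dyadicProj 𝕜 X p r q.2 f) t‖}
      = halfLine {t | ε < ‖T (stepLp 𝕜 r (max q.1 q.2) c) t‖} := by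
        rw [← hc, map_sub]
        refine measure_congr ?_
        filter_upwards [Lp.coeFn_sub (T (stepLp 𝕜 r q.1 (cellAvg q.1 f)))
          (T (stepLp 𝕜 r q.2 (cellAvg q.2 f)))] with t ht
        refine propext ?_
        change ε < _ ↔ ε < _
        rw [ht, Pi.sub_apply, dyadicProj_apply, dyadicProj_apply]
    _ ≤ D * eLpNorm (step (max q.1 q.2) c) p halfLine ^ p.toReal := hDT _ _
    _ ≤ D * (e q.1 + e q.2) ^ p.toReal := by
        gcongr
        rw [hc', ← sub_sub_sub_cancel_right _ _ (f : ℝ → X)]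
        exact eLpNorm_sub_le ((memLp_step _ _ p).1.sub (Lp.aestronglyMeasurable f))
          ((memLp_step _ _ p).1.sub (Lp.aestronglyMeasurable f)) hp1

/-- The extension of `T` from step functions to `L^p`: the limit in measure of the images of the
dyadic averages. -/
lemma exists_extension (hp : p ≠ ∞) {T : Lp X r halfLine →L[𝕜] Lp Y r halfLine}
    (hT : WeakOnSteps p T) :
    ∃ S : Lp X p halfLine →ₗ[𝕜] (ℝ →ₘ[halfLine] Y), ∀ f,
      TendstoInMeasure halfLine (fun n => T (dyadicProj 𝕜 X p r n f)) atTop (S f) := by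
  choose g hg hlim using exists_tendstoInMeasure_dyadicProj hp hT
  have hmk : ∀ f, AEEqFun.mk (g f) (hg f).aestronglyMeasurable =ᵐ[halfLine] g f :=
    fun f => AEEqFun.coeFn_mk _ _
  refine ⟨⟨⟨fun f => AEEqFun.mk (g f) (hg f).aestronglyMeasurable, fun f₁ f₂ => ?_⟩,
    fun a f => ?_⟩, fun f => (hlim f).congr_right (hmk f).symm⟩
  · rw [AEEqFun.mk_add_mk, AEEqFun.mk_eq_mk]
    refine TendstoInMeasure.ae_eq_add (hlim f₁) (hlim f₂) (hlim (f₁ + f₂)) fun n => ?_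
    rw [map_add, map_add]
    exact Lp.coeFn_add _ _
  · simp only [RingHom.id_apply]
    rw [AEEqFun.smul_mk, AEEqFun.mk_eq_mk]
    refine TendstoInMeasure.ae_eq_smul a (hlim f) (hlim (a • f)) fun n => ?_
    rw [map_smul, map_smul]
    exact Lp.coeFn_smul _ _

omit [CompleteSpace Y] in
/-- The limits in measure extend `T` in the required sense, because the dyadic averages of an
element of `L^r` converge to it in `L^r` if `r < ∞`, and those of a test function converge
uniformly. -/
lemma extends_of_tendstoInMeasure {T : Lp X r halfLine →L[𝕜] Lp Y r halfLine}
    {S : Lp X p halfLine → (ℝ →ₘ[halfLine] Y)}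
    (hS : ∀ f, TendstoInMeasure halfLine (fun n => T (dyadicProj 𝕜 X p r n f)) atTop (S f)) :
    Extends S T := by
  intro f g hfg hor
  have hlim : Tendsto (fun n => eLpNorm (step n (cellAvg n g) - (g : ℝ → X)) r halfLine)
      atTop (𝓝 0) := by
    by_cases hr : r = ∞
    · obtain ⟨u, hu, hus, hu0, hfu⟩ := hor.resolve_left (not_not.2 hr)
      have hgu : g =ᵐ[halfLine] u := hfg.symm.trans hfu
      have hlim := tendsto_eLpNorm_top_step_cellAvg_sub hu hus hu0
      rw [← hr] at hlim
      refine hlim.congr fun n => ?_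
      rw [show cellAvg n g = cellAvg n u from funext fun j => cellAvg_congr hgu]
      exact eLpNorm_congr_ae (EventuallyEq.rfl.sub hgu.symm)
    · exact tendsto_eLpNorm_step_cellAvg_sub Fact.out hr (Lp.memLp g)
  have hproj : Tendsto (fun n => dyadicProj 𝕜 X p r n f) atTop (𝓝 g) := by
    rw [Lp.tendsto_Lp_iff_tendsto_eLpNorm']
    refine hlim.congr fun n => eLpNorm_congr_ae (EventuallyEq.sub ?_ EventuallyEq.rfl)
    rw [dyadicProj_apply, show cellAvg n f = cellAvg n g from funext fun j => cellAvg_congr hfg]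
    exact (coeFn_stepLp r n _).symm
  exact tendstoInMeasure_ae_unique (hS f)
    (tendstoInMeasure_of_tendsto_Lp ((T.continuous.tendsto g).comp hproj))

omit [IsScalarTower ℝ 𝕜 X] [CompleteSpace X] [CompleteSpace Y] in
lemma eLpNorm_step_cellAvg_le_enorm (n : ℕ) (f : Lp X p halfLine) :
    eLpNorm (step n (cellAvg n f)) p halfLine ≤ ‖f‖ₑ := by
  rw [Lp.enorm_def]
  exact eLpNorm_step_cellAvg_le n (Lp.aestronglyMeasurable f) Fact.out

/-- The weak type `(1, 1)` bound passes to the extension. -/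
lemma exists_extension_weakL1 {T : Lp X r halfLine →L[𝕜] Lp Y r halfLine} {C : ℝ}
    (h : ∀ (n : ℕ) (c : ℕ → X) (a : ℝ), 0 < a → halfLine {t | a < ‖T (stepLp 𝕜 r n c) t‖} ≤
      (ENNReal.ofReal a)⁻¹ * (ENNReal.ofReal C * eLpNorm (step n c) 1 halfLine)) :
    ∃ S : Lp X 1 halfLine →ₗ[𝕜] (ℝ →ₘ[halfLine] Y), Extends (fun f => S f) T ∧
      ∀ f : Lp X 1 halfLine, weakL1Norm (S f) ≤ ENNReal.ofReal C * ‖f‖ₑ := by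
  have hw : WeakOnSteps 1 T := by
    intro ε hε
    refine ⟨(ENNReal.ofReal ε)⁻¹ * ENNReal.ofReal C,
      ENNReal.mul_ne_top (ENNReal.inv_ne_top.2 (by simpa using hε)) ENNReal.ofReal_ne_top,
      fun n c => ?_⟩
    rw [ENNReal.toReal_one, ENNReal.rpow_one, mul_assoc]
    exact h n c ε hε
  obtain ⟨S, hS⟩ := exists_extension ENNReal.one_ne_top hw
  refine ⟨S, extends_of_tendstoInMeasure hS, fun f => iSup_le fun a => ?_⟩
  rcases eq_or_ne a 0 with rfl | ha
  · rw [ENNReal.coe_zero, zero_mul]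
    exact zero_le
  have ha0 : (0 : ℝ) < a := by positivity
  rw [ENNReal.mul_le_iff_le_inv (by simpa using ha) ENNReal.coe_ne_top, ← ENNReal.ofReal_coe_nnreal]
  obtain ⟨φ, -, hlim⟩ := (hS f).exists_seq_tendsto_ae
  refine measure_lt_norm_le_of_tendsto hlim (Eventually.of_forall fun k => ?_)
  refine (h _ _ a ha0).trans ?_
  gcongr
  exact eLpNorm_step_cellAvg_le_enorm _ f

/-- The strong type `(p, p)` bound passes to the extension. -/
lemma exists_extension_Lp (hp : p ≠ ∞) {T : Lp X r halfLine →L[𝕜] Lp Y r halfLine} {C : ℝ}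
    (hC : 0 ≤ C) (h : ∀ (n : ℕ) (c : ℕ → X), eLpNorm (T (stepLp 𝕜 r n c)) p halfLine ≤
      ENNReal.ofReal C * eLpNorm (step n c) p halfLine) :
    ∃ S : Lp X p halfLine →L[𝕜] Lp Y p halfLine,
      Extends (fun f => (S f : ℝ →ₘ[halfLine] Y)) T ∧
      ∀ f : Lp X p halfLine, ‖S f‖ ≤ C * ‖f‖ := by
  have hp1 : 1 ≤ p := Fact.out
  have hp0 : p ≠ 0 := (zero_lt_one.trans_le hp1).ne'
  have hw : WeakOnSteps p T := by
    intro ε hε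
    have hε' : ENNReal.ofReal ε ≠ 0 := by simpa using hε
    refine ⟨(ENNReal.ofReal ε)⁻¹ ^ p.toReal * ENNReal.ofReal C ^ p.toReal,
      ENNReal.mul_ne_top (ENNReal.rpow_ne_top_of_nonneg ENNReal.toReal_nonneg
        (ENNReal.inv_ne_top.2 hε')) (ENNReal.rpow_ne_top_of_nonneg ENNReal.toReal_nonneg
        ENNReal.ofReal_ne_top), fun n c => ?_⟩
    rw [mul_assoc, ← ENNReal.mul_rpow_of_nonneg _ _ ENNReal.toReal_nonneg]
    calc halfLine {t | ε < ‖T (stepLp 𝕜 r n c) t‖}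
        ≤ halfLine {t | ENNReal.ofReal ε ≤ ‖T (stepLp 𝕜 r n c) t‖ₑ} := by
          refine measure_mono fun t ht => ?_
          have ht' : ε < ‖T (stepLp 𝕜 r n c) t‖ := ht
          change ENNReal.ofReal ε ≤ _
          rw [← ofReal_norm]
          exact ENNReal.ofReal_le_ofReal ht'.le
      _ ≤ (ENNReal.ofReal ε)⁻¹ ^ p.toReal * eLpNorm (T (stepLp 𝕜 r n c)) p halfLine ^ p.toReal :=
          meas_ge_le_mul_pow_eLpNorm_enorm _ hp0 hp (Lp.aestronglyMeasurable _) hε'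
            fun h => absurd h ENNReal.ofReal_ne_top
      _ ≤ _ := by
          gcongr
          exact h n c
  obtain ⟨S, hS⟩ := exists_extension hp hw
  have hbound : ∀ f, eLpNorm (S f) p halfLine ≤ ENNReal.ofReal C * ‖f‖ₑ := by
    intro f
    refine eLpNorm_le_of_tendstoInMeasure (Eventually.of_forall fun n => ?_) (hS f)
      fun n => Lp.aestronglyMeasurable _
    refine (h n _).trans ?_
    gcongr
    exact eLpNorm_step_cellAvg_le_enorm n f
  have hmem : ∀ f, S f ∈ Lp Y p halfLine := fun f =>
    Lp.mem_Lp_iff_eLpNorm_lt_top.2 ((hbound f).trans_lt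
      (ENNReal.mul_lt_top ENNReal.ofReal_lt_top enorm_lt_top))
  have hnorm : ∀ f, ‖(⟨S f, hmem f⟩ : Lp Y p halfLine)‖ ≤ C * ‖f‖ := by
    intro f
    rw [Lp.norm_def, ← toReal_enorm f, ← ENNReal.toReal_ofReal hC, ← ENNReal.toReal_mul]
    exact ENNReal.toReal_mono (ENNReal.mul_ne_top ENNReal.ofReal_ne_top enorm_ne_top) (hbound f)
  refine ⟨LinearMap.mkContinuous
    (({ toFun := fun f => ⟨S f, hmem f⟩
        map_add' := fun f g => Subtype.ext (map_add S f g)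
        map_smul' := fun a f => Subtype.ext (map_smul S a f) }) :
      Lp X p halfLine →ₗ[𝕜] Lp Y p halfLine) C hnorm, ?_, hnorm⟩
  exact extends_of_tendstoInMeasure hS

end Extension

/-! ### The extensions of a Volterra singular integral operator -/

theorem theorem2p1 (σ : ℝ) (hσ : 0 < σ) (hσ1 : σ ≤ 1) :
    ∃ (C : ℝ) (Cp : ℝ≥0∞ → ℝ),
      ∀ (𝕜 X Y : Type*) [RCLike 𝕜]
        [NormedAddCommGroup X] [NormedSpace 𝕜 X] [CompleteSpace X]
        [NormedAddCommGroup Y] [NormedSpace 𝕜 Y] [CompleteSpace Y],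
        IsReflexiveSpace 𝕜 X → IsReflexiveSpace 𝕜 Y →
      ∀ (r : ℝ≥0∞) [Fact (1 ≤ r)], 1 < r →
      ∀ (M : ℝ) (T : Lp X r halfLine →L[𝕜] Lp Y r halfLine), IsVolterraOperator σ M T →
        (∃ T₁ : Lp X 1 halfLine →ₗ[𝕜] (ℝ →ₘ[halfLine] Y), Extends (fun f => T₁ f) T ∧
          ∀ f : Lp X 1 halfLine,
            weakL1Norm (T₁ f) ≤ ENNReal.ofReal (C * (M + ‖T‖)) * ‖f‖ₑ) ∧
        (∀ (p : ℝ≥0∞) [Fact (1 ≤ p)], 1 < p → p < ∞ →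
          ∃ Tp : Lp X p halfLine →L[𝕜] Lp Y p halfLine,
            Extends (fun f => (Tp f : ℝ →ₘ[halfLine] Y)) T ∧
            ∀ f : Lp X p halfLine, ‖Tp f‖ ≤ Cp p * (M + ‖T‖) * ‖f‖) := by
  -- `38` is the constant of `weakOne_of_hormander`, and `1 / σ` is the sum of the kernel decay.
  refine ⟨38 / σ, fun p => czConst p.toReal / σ, ?_⟩
  intro 𝕜 X Y _ _ _ _ _ _ _ _ _ r _ hr M T hT
  let : NormedSpace ℝ X := NormedSpace.restrictScalars ℝ 𝕜 X
  let : NormedSpace ℝ Y := NormedSpace.restrictScalars ℝ 𝕜 Y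
  have : IsScalarTower ℝ 𝕜 X := ⟨fun a b x => by
    change (a • b) • x = algebraMap ℝ 𝕜 a • b • x
    rw [Algebra.smul_def, mul_smul]⟩
  have : IsScalarTower ℝ 𝕜 Y := ⟨fun a b x => by
    change (a • b) • x = algebraMap ℝ 𝕜 a • b • x
    rw [Algebra.smul_def, mul_smul]⟩
  obtain ⟨K, hK, hTK⟩ := hT
  have hM := hK.nonneg
  have hT0 : 0 ≤ ‖T‖ := norm_nonneg T
  -- A common bound for the operator norms and the Hörmander constants of all the matrices.
  set κ := (M + ‖T‖) / σ with hκ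
  have hκ0 : 0 ≤ κ := by positivity
  have hMκ : M / σ ≤ κ := by
    rw [hκ]
    gcongr
    linarith
  have hTκ : ‖T‖ ≤ κ := by
    rw [hκ, le_div_iff₀ hσ]
    nlinarith
  have hmat := fun n => bounds_of_hormander hκ0 ((hormander_opMatrix hσ hK hTK n).mono hMκ)
    ((hormander_dualMatrix_opMatrix hσ hK hTK n).mono hMκ) hr
    (fun h c R hc i hi => (supBound_opMatrix T n h c R hc i hi).trans
      (mul_le_mul_of_nonneg_right hTκ ((norm_nonneg _).trans (hc i hi))))
    (fun h => (strongBound_opMatrix T n h).mono ENNReal.toReal_nonneg hT0 hTκ)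
  constructor
  · have e : 38 / σ * (M + ‖T‖) = 38 * κ := by rw [hκ]; ring
    rw [e]
    exact exists_extension_weakL1 fun n c a ha =>
      measure_apply_stepLp_le (by positivity) (fun n => (hmat n).1) n c ha
  · intro p _ hp hpt
    have hp1 : 1 < p.toReal := by
      rw [← ENNReal.toReal_one]
      exact (ENNReal.toReal_lt_toReal ENNReal.one_ne_top hpt.ne).2 hp
    have e : czConst p.toReal / σ * (M + ‖T‖) = czConst p.toReal * κ := by rw [hκ]; ring
    have hc : 0 ≤ czConst p.toReal :=
      (interpConst_nonneg hp1 (by linarith)).trans (le_max_left _ _)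
    have hC : 0 ≤ czConst p.toReal * κ := by positivity
    rw [e]
    refine exists_extension_Lp hpt.ne hC fun n c => ?_
    have := eLpNorm_apply_stepLp_le (by linarith) hC (fun n => (hmat n).2 p.toReal hp1) n c
    rwa [ENNReal.ofReal_toReal hpt.ne] at this
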